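/- For $\gamma>0$ let $\mathbb H_\gamma=\{(z_1,z_2)\in\mathbb C^2: |z_1|^\gamma<|z_2|<1\}$. The Bergman kernel $K_\Omega$ of a domain $\Omega\subset\mathbb C^2$ is the reproducing kernel of the space $A^2(\Omega)$ of holomorphic functions in $L^2(\Omega)$ (with respect to Lebesgue measure); it is said to have zeros if $K_\Omega(z,w)=0$ for some $(z,w)\in\Omega\times\Omega$. For coprime integers $m>n\ge 1$ put $$L(j)=\left\lceil \frac{1+n(j+1)}{m}\right\rceil,\qquad \kappa(j)=m+n-1+nj-mL(j),$$ $$\begin{aligned}P_{m,n}(s,t)=m^2s^{m-1}t^n&+\sum_{j=0}^{m-2}(j+1)(\kappa(j)+1)s^jt^{2n-L(j)}+\sum_{j=0}^{m-2}(j+1)(m-\kappa(j)-1)s^jt^{2n+1-L(j)}\\&+\sum_{j=0}^{m-2}(m-j-1)(\kappa(j)+1)s^{j+m}t^{n-L(j)}+\sum_{j=0}^{m-2}(m-j-1)(m-\kappa(j)-1)s^{j+m}t^{n+1-L(j)},\end{aligned}$$ and $Q_{m,n}(s)=s^{1-2n}P_{m,n}(s,s)$. **Theorem 1.3.** Let $m>n\ge1$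 be coprime integers with $m-n\in\{1,2\}$. Then $Q_{m,n}$ is a polynomial of degree $2(m-n)$ with $Q_{m,n}(0)\neq 0$, it has no roots on the unit circle, and exactly half of its roots, that is $m-n$ of them counted with multiplicity, lie in the punctured unit disc $\{0<|s|<1\}$. Moreover, the Bergman kernel of $\mathbb H_{m/n}$ exists and has zeros in $\mathbb H_{m/n}\times\mathbb H_{m/n}$. In particular, for every integer $\ell\ge1$ the Bergman kernels of $\mathbb H_\gamma$ with $\gamma=\frac{\ell+1}{\ell}$ and with $\gamma=\frac{2\ell+1}{2\ell-1}$ have zeros. Each of these two sequences of values of $\gamma$ lies in $(1,\infty)$ and decreases strictly to $1$ as $\ell\to\infty$. Consequently, for every $\varepsilon>0$ there is $\gamma\in(1,1+\varepsilon)$ for which the Bergman kernel of $\mathbb H_\gamma$ has zeros. -/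

import Mathlib

open MeasureTheory Polynomial Filter Topology

/-- The generalized Hartogs triangle `{(z₁, z₂) ∈ ℂ² : |z₁|^γ < |z₂| < 1}`. -/
def hartogsTriangle (γ : ℝ) : Set (ℂ × ℂ) :=
  {z | ‖z.1‖ ^ γ < ‖z.2‖ ∧ ‖z.2‖ < 1}

/-- `f` (restricted to `Ω`) belongs to the Bergman space `A²(Ω)`: it is holomorphic and square
integrable on `Ω` for Lebesgue measure. -/
def MemBergmanSpace (Ω : Set (ℂ × ℂ)) (f : ℂ × ℂ → ℂ) : Prop :=
  DifferentiableOn ℂ f Ω ∧ MemLp f 2 (volume.restrict Ω)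

/-- `K`, restricted to `Ω × Ω`, is the Bergman kernel of `Ω`, that is, the reproducing kernel of
`A²(Ω)`. Only the values on `Ω × Ω` matter, and they are determined by `Ω`
(see `IsBergmanKernel.eq_of_mem`). -/
structure IsBergmanKernel (Ω : Set (ℂ × ℂ)) (K : ℂ × ℂ → ℂ × ℂ → ℂ) : Prop where
  mem : ∀ w ∈ Ω, MemBergmanSpace Ω (fun z => K z w)
  conj_symm : ∀ z ∈ Ω, ∀ w ∈ Ω, K z w = (starRingEnd ℂ) (K w z)
  reproducing : ∀ f, MemBergmanSpace Ω f → ∀ z ∈ Ω, f z = ∫ w in Ω, K z w * f w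

/-- Uniqueness of the Bergman kernel. -/
theorem IsBergmanKernel.eq_of_mem {Ω : Set (ℂ × ℂ)} (hΩ : MeasurableSet Ω)
    {K K' : ℂ × ℂ → ℂ × ℂ → ℂ} (hK : IsBergmanKernel Ω K) (hK' : IsBergmanKernel Ω K')
    {z w : ℂ × ℂ} (hz : z ∈ Ω) (hw : w ∈ Ω) : K z w = K' z w := by
  have h1 := hK'.reproducing _ (hK.mem w hw) z hz
  have h2 := hK.reproducing _ (hK'.mem z hz) w hw
  rw [hK'.conj_symm z hz w hw, h2, h1, ← integral_conj]
  refine setIntegral_congr_fun hΩ fun u hu => ?_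
  simp only [map_mul]
  rw [← hK.conj_symm u hu w hw, ← hK'.conj_symm z hz u hu, mul_comm]

/-- `Ω` has a Bergman kernel, and this kernel vanishes at some point of `Ω × Ω`. -/
def BergmanKernelHasZeros (Ω : Set (ℂ × ℂ)) : Prop :=
  ∃ K, IsBergmanKernel Ω K ∧ ∃ z ∈ Ω, ∃ w ∈ Ω, K z w = 0

/-- `L(j) = ⌈(1 + n (j + 1)) / m⌉`. -/
def ceilL (m n j : ℕ) : ℤ := ⌈((1 + n * (j + 1) : ℚ) / m)⌉

/-- `κ(j) = m + n - 1 + n j - m L(j)`. -/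
def kappa (m n j : ℕ) : ℤ := m + n - 1 + n * j - m * ceilL m n j

/-- The numerator polynomial `P_{m,n}(s, t)`, with `s = X 0` and `t = X 1`. For coprime `m > n ≥ 1`
and `j ≤ m - 2` one has `1 ≤ L(j) ≤ n`, so no exponent below is truncated by `Int.toNat`. -/
noncomputable def numeratorP (m n : ℕ) : MvPolynomial (Fin 2) ℂ :=
  let s : MvPolynomial (Fin 2) ℂ := MvPolynomial.X 0
  let t : MvPolynomial (Fin 2) ℂ := MvPolynomial.X 1
  (m : MvPolynomial (Fin 2) ℂ) ^ 2 * s ^ (m - 1) * t ^ n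
  + ∑ j ∈ Finset.range (m - 1),
      (((j + 1) * (kappa m n j + 1) : ℤ) : MvPolynomial (Fin 2) ℂ)
        * s ^ j * t ^ (2 * n - ceilL m n j).toNat
  + ∑ j ∈ Finset.range (m - 1),
      (((j + 1) * (m - kappa m n j - 1) : ℤ) : MvPolynomial (Fin 2) ℂ)
        * s ^ j * t ^ (2 * n + 1 - ceilL m n j).toNat
  + ∑ j ∈ Finset.range (m - 1),
      (((m - j - 1) * (kappa m n j + 1) : ℤ) : MvPolynomial (Fin 2) ℂ)
        * s ^ (j + m) * t ^ (n - ceilL m n j).toNat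
  + ∑ j ∈ Finset.range (m - 1),
      (((m - j - 1) * (m - kappa m n j - 1) : ℤ) : MvPolynomial (Fin 2) ℂ)
        * s ^ (j + m) * t ^ (n + 1 - ceilL m n j).toNat

/-- The restriction `P_{m,n}(s, s)` of the numerator to the diagonal. -/
noncomputable def diagonalP (m n : ℕ) : ℂ[X] :=
  MvPolynomial.aeval (fun _ => (X : ℂ[X])) (numeratorP m n)

/-- `Q_{m,n}(s) = s^{1 - 2n} P_{m,n}(s, s)`, as a quotient of polynomials (the division is exact
when `m > n ≥ 1` are coprime). -/
noncomputable def polyQ (m n : ℕ) : ℂ[X] := diagonalP m n / X ^ (2 * n - 1)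

/-! `hartogsTriangle γ` is the disc bundle `|z₁| < |z₂| ^ (1/γ)` over the punctured unit disc. Its
square-integrable monomials are orthogonal: `z₁ ^ a z₂ ^ b` qualifies exactly when the weight `x = b
+ 1 + (a + 1)/γ` is positive, and its squared norm is `π² / ((a + 1) x)`. The Bergman kernel is
therefore the series of normalised monomials. For the reproducing property, a Bergman function must
have no other monomials in its Laurent expansion. Its `a`-th Taylor coefficient in `z₁` is
holomorphic in `z₂` off the origin, and square integrability limits the pole there
(`exists_laurentCoeff`, `hartogsKernel_reproducing`).

For `γ = m/n` the step `(a, b) ↦ (a + m, b - n)` preserves the weight. Splitting `a` into classes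
mod `m` thus turns the series into finitely many products of differentiated geometric series in `t =
z₂ w̄₂` and `s^m / t^n`, where `s = z₁ w̄₁`. Clearing denominators that do not vanish leaves
`P_{m,n}(s, t)` (`hartogsKernel_div_mul_eq`).

As `γ > 1`, the points `(x, x)` with `0 < |x| < 1` belong to the domain, so every root of `Q_{m,n}`
in the punctured disc gives a zero of the kernel. For `m - n = 1, 2` the sums can be evaluated, and
`Q_{m,n}` is palindromic of degree 2 or 4 (`diagonalP_succ`, `diagonalP_two`). In the variable `w =
s + s⁻¹` it has degree 1 or 2, with no root in `[-2, 2]`, the image of the unit circle. Each root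
`w` then accounts for a pair `r`, `r⁻¹` with `|r| < 1` (`exists_add_inv_eq`). -/

/-! ### Taylor coefficients and radial integrals over discs -/

/-- The `k`-th Taylor coefficient of `G` at the origin. -/
noncomputable def taylorCoeff (k : ℕ) (G : ℂ → ℂ) : ℂ :=
  (k.factorial : ℂ)⁻¹ * iteratedDeriv k G 0

theorem hasSum_taylorCoeff {G : ℂ → ℂ} {R : ℝ} (hG : DifferentiableOn ℂ G (Metric.ball 0 R))
    {z : ℂ} (hz : z ∈ Metric.ball (0 : ℂ) R) :
    HasSum (fun k => taylorCoeff k G * z ^ k) (G z) := by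
  refine (Complex.hasSum_taylorSeries_on_ball hG hz).congr_fun fun k => ?_
  simp only [taylorCoeff, sub_zero, smul_eq_mul]
  ring

theorem taylorCoeff_eq_cauchyPowerSeries {G : ℂ → ℂ} {R r : ℝ}
    (hG : DifferentiableOn ℂ G (Metric.ball 0 R)) (hr : 0 < r) (hrR : r < R) (k : ℕ) :
    taylorCoeff k G = cauchyPowerSeries G 0 r k fun _ => 1 := by
  lift r to NNReal using hr.le
  have h := (DifferentiableOn.hasFPowerSeriesOnBall
    (hG.mono (Metric.closedBall_subset_ball hrR)) (by exact_mod_cast hr)).factorial_smul 1 k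
  rw [taylorCoeff, iteratedDeriv_eq_iteratedFDeriv, ← h, nsmul_eq_mul, ← mul_assoc,
    inv_mul_cancel₀ (by exact_mod_cast k.factorial_ne_zero), one_mul]

/-- On the circle `conj z = r² / z`, so this is Cauchy's integral for the coefficient. The range
`-π..π` is that of polar coordinates; periodicity moves it to `0..2π`. -/
theorem integral_conj_pow_mul_circleMap {G : ℂ → ℂ} {R r : ℝ}
    (hG : DifferentiableOn ℂ G (Metric.ball 0 R)) (hr : 0 < r) (hrR : r < R) (k : ℕ) :
    ∫ θ in (-Real.pi)..Real.pi,
      (starRingEnd ℂ) (circleMap 0 r θ) ^ k * G (circleMap 0 r θ) =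
      2 * Real.pi * (r : ℂ) ^ (2 * k) * taylorCoeff k G := by
  have hper : Function.Periodic
      (fun θ => (starRingEnd ℂ) (circleMap 0 r θ) ^ k * G (circleMap 0 r θ)) (2 * Real.pi) :=
    fun θ => by simp only [periodic_circleMap 0 r θ]
  have h1 := hper.intervalIntegral_add_eq (-Real.pi) 0
  rw [show -Real.pi + 2 * Real.pi = Real.pi by ring, zero_add] at h1
  rw [h1, taylorCoeff_eq_cauchyPowerSeries hG hr hrR, cauchyPowerSeries_apply, circleIntegral]
  have hpi : (Real.pi : ℂ) ≠ 0 := by exact_mod_cast Real.pi_ne_zero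
  rw [smul_eq_mul, ← intervalIntegral.integral_const_mul, ← intervalIntegral.integral_const_mul]
  refine intervalIntegral.integral_congr fun θ _ => ?_
  have hz : circleMap 0 r θ ≠ 0 := circleMap_ne_center hr.ne'
  have hc : (starRingEnd ℂ) (circleMap 0 r θ) = (r : ℂ) ^ 2 / circleMap 0 r θ := by
    rw [eq_div_iff hz, mul_comm, Complex.mul_conj, Complex.normSq_eq_norm_sq, norm_circleMap_zero]
    simp
  simp only [hc, deriv_circleMap, sub_zero, smul_eq_mul, div_pow, one_pow, ← pow_mul]
  field_simp

theorem circleMap_zero_eq_polarCoord_symm (p : ℝ × ℝ) :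
    Complex.polarCoord.symm p = circleMap 0 p.1 p.2 := by
  rw [Complex.polarCoord_symm_apply, circleMap_zero, Complex.exp_mul_I]
  simp

theorem indicator_polar {E : Type*} [Zero E] (F : ℂ → E) (R : ℝ) {p : ℝ × ℝ}
    (hp : p ∈ polarCoord.target) :
    (Metric.ball (0 : ℂ) R).indicator F (Complex.polarCoord.symm p) =
      {q : ℝ × ℝ | q.1 < R}.indicator (fun q => F (circleMap 0 q.1 q.2)) p := by
  have h1 : 0 < p.1 := hp.1
  rw [circleMap_zero_eq_polarCoord_symm]
  by_cases h : p.1 < R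
  · rw [Set.indicator_of_mem (by simpa [abs_of_pos h1] using h),
      Set.indicator_of_mem (s := {q : ℝ × ℝ | q.1 < R}) h]
  · rw [Set.indicator_of_notMem (by simpa [abs_of_pos h1] using h),
      Set.indicator_of_notMem (s := {q : ℝ × ℝ | q.1 < R}) h]

theorem polarCoord_target_inter (R : ℝ) :
    {q : ℝ × ℝ | q.1 < R} ∩ polarCoord.target =
      Set.Ioo 0 R ×ˢ Set.Ioo (-Real.pi) Real.pi := by
  ext p
  simp only [polarCoord_target, Set.mem_inter_iff, Set.mem_prod, Set.mem_Ioi, Set.mem_Ioo,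
    Set.mem_ofPred_eq]
  tauto

theorem setLIntegral_ball_polar (F : ℂ → ENNReal) (R : ℝ) :
    ∫⁻ z in Metric.ball (0 : ℂ) R, F z =
      ∫⁻ p in Set.Ioo 0 R ×ˢ Set.Ioo (-Real.pi) Real.pi,
        ENNReal.ofReal p.1 * F (circleMap 0 p.1 p.2) := by
  have hm : MeasurableSet {p : ℝ × ℝ | p.1 < R} := measurableSet_lt measurable_fst measurable_const
  rw [← lintegral_indicator Metric.isOpen_ball.measurableSet,
    ← Complex.lintegral_comp_polarCoord_symm, ← polarCoord_target_inter,
    ← Measure.restrict_restrict hm, ← lintegral_indicator hm]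
  refine setLIntegral_congr_fun polarCoord.open_target.measurableSet fun p hp => ?_
  simp only [smul_eq_mul, indicator_polar F R hp]
  by_cases h : p ∈ {q : ℝ × ℝ | q.1 < R}
  · simp only [Set.indicator_of_mem h]
  · simp only [Set.indicator_of_notMem h, mul_zero]

/-- Continuity is asked only off the origin, because the integrands contain `‖z‖ ^ p` with `p`
possibly negative. Integrability in polar coordinates, needed for Fubini, is read off from the
`lintegral` version. -/
theorem setIntegral_ball_polar {F : ℂ → ℂ} {R : ℝ}
    (hF : ContinuousOn F (Metric.ball 0 R \ {0})) (hint : IntegrableOn F (Metric.ball 0 R)) :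
    ∫ z in Metric.ball (0 : ℂ) R, F z =
      ∫ r in Set.Ioo 0 R, ∫ θ in (-Real.pi)..Real.pi, (r : ℂ) * F (circleMap 0 r θ) := by
  have hm : MeasurableSet {p : ℝ × ℝ | p.1 < R} := measurableSet_lt measurable_fst measurable_const
  have hmS : MeasurableSet (Set.Ioo 0 R ×ˢ Set.Ioo (-Real.pi) Real.pi) :=
    measurableSet_Ioo.prod measurableSet_Ioo
  have h1 : ∫ z in Metric.ball (0 : ℂ) R, F z =
      ∫ p in Set.Ioo 0 R ×ˢ Set.Ioo (-Real.pi) Real.pi,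
        ((p.1 : ℝ) : ℂ) * F (circleMap 0 p.1 p.2) := by
    rw [← integral_indicator Metric.isOpen_ball.measurableSet,
      ← Complex.integral_comp_polarCoord_symm, ← polarCoord_target_inter,
      ← Measure.restrict_restrict hm, ← integral_indicator hm]
    refine setIntegral_congr_fun polarCoord.open_target.measurableSet fun p hp => ?_
    simp only [Complex.real_smul, indicator_polar F R hp]
    by_cases h : p ∈ {q : ℝ × ℝ | q.1 < R}
    · simp only [Set.indicator_of_mem h]
    · simp only [Set.indicator_of_notMem h, mul_zero]
  have hcont : ContinuousOn (fun p : ℝ × ℝ => ((p.1 : ℝ) : ℂ) * F (circleMap 0 p.1 p.2))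
      (Set.Ioo 0 R ×ˢ Set.Ioo (-Real.pi) Real.pi) := by
    refine ContinuousOn.mul (by fun_prop) (hF.comp (t := Metric.ball 0 R \ {0}) ?_ fun p hp => ?_)
    · simp only [circleMap]
      fun_prop
    · have h0 : 0 < p.1 := hp.1.1
      refine ⟨by simpa [abs_of_pos h0] using hp.1.2, ?_⟩
      exact circleMap_ne_center h0.ne'
  have hInt : IntegrableOn (fun p : ℝ × ℝ => ((p.1 : ℝ) : ℂ) * F (circleMap 0 p.1 p.2))
      (Set.Ioo 0 R ×ˢ Set.Ioo (-Real.pi) Real.pi) := by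
    refine ⟨hcont.aestronglyMeasurable hmS, ?_⟩
    have h2 := hint.2
    rw [HasFiniteIntegral, setLIntegral_ball_polar] at h2
    rw [HasFiniteIntegral]
    refine lt_of_eq_of_lt (setLIntegral_congr_fun hmS fun p hp => ?_) h2
    have h0 : 0 < p.1 := hp.1.1
    simp only [enorm_mul]
    congr 1
    rw [← ofReal_norm, Complex.norm_real, Real.norm_of_nonneg h0.le]
  rw [h1, Measure.volume_eq_prod, setIntegral_prod _ hInt]
  refine setIntegral_congr_fun measurableSet_Ioo fun r _ => ?_
  simp only
  rw [intervalIntegral.integral_of_le (by linarith [Real.pi_pos]), integral_Ioc_eq_integral_Ioo]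

theorem integral_Ioo_rpow {R p : ℝ} (hR : 0 ≤ R) (hp : 0 < p + 1) :
    ∫ r in Set.Ioo 0 R, r ^ p = R ^ (p + 1) / (p + 1) := by
  rw [← integral_Ioc_eq_integral_Ioo, ← intervalIntegral.integral_of_le hR,
    integral_rpow (Or.inl (by linarith)), Real.zero_rpow hp.ne', sub_zero]

theorem setLIntegral_ball_norm_rpow {R p : ℝ} (hR : 0 ≤ R) (hp : 0 < p + 2) :
    ∫⁻ z in Metric.ball (0 : ℂ) R, ENNReal.ofReal (‖z‖ ^ p) =
      ENNReal.ofReal (2 * Real.pi * R ^ (p + 2) / (p + 2)) := by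
  have hint : IntegrableOn (fun r : ℝ => r ^ (p + 1)) (Set.Ioo 0 R) :=
    (intervalIntegrable_iff_integrableOn_Ioo_of_le hR).1
      (intervalIntegral.intervalIntegrable_rpow' (by linarith))
  have h1 : ∫⁻ r in Set.Ioo 0 R, ENNReal.ofReal (r ^ (p + 1)) =
      ENNReal.ofReal (R ^ (p + 2) / (p + 2)) := by
    rw [← ofReal_integral_eq_lintegral_ofReal hint, integral_Ioo_rpow hR (by linarith),
      show p + 1 + 1 = p + 2 by ring]
    · exact (ae_restrict_mem measurableSet_Ioo).mono fun r hr => Real.rpow_nonneg hr.1.le _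
  rw [setLIntegral_ball_polar]
  have h2 : ∫⁻ q in Set.Ioo 0 R ×ˢ Set.Ioo (-Real.pi) Real.pi,
      ENNReal.ofReal q.1 * ENNReal.ofReal (‖circleMap 0 q.1 q.2‖ ^ p) =
      ∫⁻ q in Set.Ioo 0 R ×ˢ Set.Ioo (-Real.pi) Real.pi, ENNReal.ofReal (q.1 ^ (p + 1)) := by
    refine setLIntegral_congr_fun (measurableSet_Ioo.prod measurableSet_Ioo) fun q hq => ?_
    have h0 : 0 < q.1 := hq.1.1
    simp only [norm_circleMap_zero, abs_of_pos h0]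
    rw [← ENNReal.ofReal_mul h0.le, Real.rpow_add_one h0.ne', mul_comm]
  rw [h2, Measure.volume_eq_prod, setLIntegral_prod _ (by fun_prop)]
  simp only [lintegral_const, Measure.restrict_apply MeasurableSet.univ, Set.univ_inter,
    Real.volume_Ioo]
  rw [lintegral_mul_const _ (by fun_prop), h1, ← ENNReal.ofReal_mul (by positivity)]
  congr 1
  ring

/-- A radial weight keeps distinct powers orthogonal. Working circle by circle avoids any
convergence question at the boundary of the disc. -/
theorem setIntegral_ball_taylorCoeff {G : ℂ → ℂ} {R p : ℝ} (hR : 0 < R)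
    (hG : DifferentiableOn ℂ G (Metric.ball 0 R)) (k : ℕ) (hp : 0 < p + 2 * k + 2)
    (hint : IntegrableOn (fun z => ((‖z‖ ^ p : ℝ) : ℂ) * (starRingEnd ℂ) z ^ k * G z)
      (Metric.ball 0 R)) :
    ∫ z in Metric.ball (0 : ℂ) R, ((‖z‖ ^ p : ℝ) : ℂ) * (starRingEnd ℂ) z ^ k * G z =
      ((2 * Real.pi * R ^ (p + 2 * k + 2) / (p + 2 * k + 2) : ℝ) : ℂ) * taylorCoeff k G := by
  rw [setIntegral_ball_polar _ hint]
  · have h1 : ∀ r ∈ Set.Ioo 0 R, (∫ θ in (-Real.pi)..Real.pi, (r : ℂ) *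
        (((‖circleMap 0 r θ‖ ^ p : ℝ) : ℂ) * (starRingEnd ℂ) (circleMap 0 r θ) ^ k *
          G (circleMap 0 r θ))) =
        ((r ^ (p + 2 * k + 1) : ℝ) : ℂ) * (2 * Real.pi * taylorCoeff k G) := fun r hr => by
      have h2 : ∀ θ, (r : ℂ) *
        (((‖circleMap 0 r θ‖ ^ p : ℝ) : ℂ) * (starRingEnd ℂ) (circleMap 0 r θ) ^ k *
          G (circleMap 0 r θ)) = ((r * r ^ p : ℝ) : ℂ) *
          ((starRingEnd ℂ) (circleMap 0 r θ) ^ k * G (circleMap 0 r θ)) := fun θ => by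
        rw [norm_circleMap_zero, abs_of_pos hr.1]
        push_cast
        ring
      simp only [h2]
      rw [intervalIntegral.integral_const_mul, integral_conj_pow_mul_circleMap hG hr.1 hr.2,
        Real.rpow_add hr.1, Real.rpow_add hr.1, Real.rpow_one,
        show (2 * (k : ℝ)) = ((2 * k : ℕ) : ℝ) by push_cast; ring, Real.rpow_natCast]
      push_cast
      ring
    rw [setIntegral_congr_fun measurableSet_Ioo h1, integral_mul_const, integral_complex_ofReal,
      integral_Ioo_rpow hR.le (by linarith)]
    rw [show p + 2 * k + 1 + 1 = p + 2 * k + 2 by ring]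
    push_cast
    ring
  · refine ContinuousOn.mul (ContinuousOn.mul ?_ (by fun_prop))
      (hG.continuousOn.mono Set.sdiff_subset)
    refine Complex.continuous_ofReal.comp_continuousOn
      (continuous_norm.continuousOn.rpow_const fun z hz => Or.inl ?_)
    simpa using hz.2

/-! ### Taylor coefficients in the first variable -/

/-- The `a`-th Taylor coefficient of `u ↦ f (u, w)` at the origin. -/
noncomputable def sliceCoeff (a : ℕ) (f : ℂ × ℂ → ℂ) (w : ℂ) : ℂ :=
  taylorCoeff a fun u => f (u, w)

theorem taylorCoeff_const_mul (k : ℕ) (c : ℂ) (G : ℂ → ℂ) :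
    taylorCoeff k (fun z => c * G z) = c * taylorCoeff k G := by
  simp only [taylorCoeff]
  rw [iteratedDeriv_const_mul_field]
  ring

theorem DifferentiableOn.slice {f : ℂ × ℂ → ℂ} {U : Set (ℂ × ℂ)} (hf : DifferentiableOn ℂ f U)
    {w : ℂ} {s : Set ℂ} (h : ∀ u ∈ s, (u, w) ∈ U) : DifferentiableOn ℂ (fun u => f (u, w)) s :=
  hf.comp (by fun_prop : DifferentiableOn ℂ (fun u : ℂ => (u, w)) s) h

/-- Cauchy's estimate: `f` maps the ball into the closed ball of radius `2 * C` about `f c`. -/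
theorem norm_fderiv_le_of_norm_le {E F : Type*} [NormedAddCommGroup E] [NormedSpace ℂ E]
    [NormedAddCommGroup F] [NormedSpace ℂ F] {f : E → F} {c : E} {r C : ℝ} (hr : 0 < r)
    (hf : DifferentiableOn ℂ f (Metric.ball c r)) (hC : ∀ x ∈ Metric.ball c r, ‖f x‖ ≤ C) :
    ‖fderiv ℂ f c‖ ≤ 2 * C / r := by
  refine Complex.norm_fderiv_le_div_of_mapsTo_ball hf (fun x hx => ?_) hr
  rw [mem_closedBall_iff_norm]
  linarith [norm_sub_le (f x) (f c), hC x hx, hC c (Metric.mem_ball_self hr)]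

/-- The coefficient is an integral of `f (·, w)` over the fixed circle of radius `R / 2`, which can
be differentiated in `w` under the integral sign. -/
theorem differentiableAt_sliceCoeff {f : ℂ × ℂ → ℂ} {R δ : ℝ} {w₀ : ℂ} (hR : 0 < R) (hδ : 0 < δ)
    (hf : DifferentiableOn ℂ f (Metric.ball 0 R ×ˢ Metric.ball w₀ δ)) (a : ℕ) :
    DifferentiableAt ℂ (sliceCoeff a f) w₀ := by
  set U := Metric.ball (0 : ℂ) R ×ˢ Metric.ball w₀ δ with hU
  have hUo : IsOpen U := Metric.isOpen_ball.prod Metric.isOpen_ball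
  set γ : ℝ → ℂ := circleMap 0 (R / 2) with hγ
  have hγn : ∀ θ, ‖γ θ‖ = R / 2 := fun θ => by
    rw [hγ, norm_circleMap_zero, abs_of_pos (by linarith)]
  have hγU : ∀ θ, ∀ w ∈ Metric.ball w₀ δ, (γ θ, w) ∈ U := fun θ w hw =>
    ⟨by rw [mem_ball_zero_iff, hγn]; linarith, hw⟩
  have hγc : Continuous γ := continuous_circleMap 0 _
  obtain ⟨C, hC⟩ : ∃ C, ∀ z ∈ Metric.closedBall (0 : ℂ) (3 * R / 4) ×ˢ
      Metric.closedBall w₀ (δ / 2), ‖f z‖ ≤ C := by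
    refine ((isCompact_closedBall _ _).prod (isCompact_closedBall _ _)).exists_bound_of_continuousOn
      (hf.continuousOn.mono (Set.prod_mono ?_ ?_))
    · exact Metric.closedBall_subset_ball (by linarith)
    · exact Metric.closedBall_subset_ball (by linarith)
  -- With this radius, balls about `(γ θ, w)` with `w` within `δ / 4` of `w₀` stay in the compact
  -- polydisc where `C` bounds `f`; Cauchy's estimate then gives the dominating constant.
  set ε := min (R / 4) (δ / 4) with hε
  have hε0 : 0 < ε := lt_min (by linarith) (by linarith)
  have hbd : ∀ θ, ∀ w ∈ Metric.ball w₀ (δ / 4), ‖fderiv ℂ f (γ θ, w)‖ ≤ 2 * C / ε := by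
    intro θ w hw
    have hsub : Metric.ball (γ θ, w) ε ⊆ Metric.closedBall (0 : ℂ) (3 * R / 4) ×ˢ
      Metric.closedBall w₀ (δ / 2) := by
      rw [← ball_prod_same]
      refine Set.prod_mono (fun x hx => ?_) (fun x hx => ?_)
      · have h2 : ‖x - γ θ‖ < R / 4 := (mem_ball_iff_norm.1 hx).trans_le (min_le_left _ _)
        rw [mem_closedBall_iff_norm, sub_zero]
        linarith [norm_le_norm_add_norm_sub' x (γ θ), hγn θ]
      · have h2 : dist x w < δ / 4 := hx.trans_le (min_le_right _ _)
        rw [Metric.mem_closedBall]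
        linarith [dist_triangle x w w₀, Metric.mem_ball.1 hw]
    refine norm_fderiv_le_of_norm_le hε0 (hf.mono (hsub.trans (Set.prod_mono ?_ ?_)))
      fun x hx => hC x (hsub hx)
    · exact Metric.closedBall_subset_ball (by linarith)
    · exact Metric.closedBall_subset_ball (by linarith)
  have hcont : ∀ w ∈ Metric.ball w₀ δ,
      Continuous fun θ => (starRingEnd ℂ) (γ θ) ^ a * f (γ θ, w) := fun w hw => by
    refine Continuous.mul (by fun_prop) ?_
    exact hf.continuousOn.comp_continuous (by fun_prop) fun θ => hγU θ w hw
  have hmain := intervalIntegral.hasDerivAt_integral_of_dominated_loc_of_deriv_le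
    (μ := volume) (a := -Real.pi) (b := Real.pi) (x₀ := w₀) (s := Metric.ball w₀ (δ / 4))
    (F := fun w θ => (starRingEnd ℂ) (γ θ) ^ a * f (γ θ, w))
    (F' := fun w θ => (starRingEnd ℂ) (γ θ) ^ a * fderiv ℂ f (γ θ, w) (0, 1))
    (bound := fun _ => (R / 2) ^ a * (2 * C / ε)) (Metric.ball_mem_nhds _ (by linarith)) ?_ ?_ ?_
    ?_ ?_ ?_
  · have heq : sliceCoeff a f =ᶠ[𝓝 w₀] fun w => (2 * Real.pi * ((R / 2 : ℝ) : ℂ) ^ (2 * a))⁻¹ *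
        ∫ θ in (-Real.pi)..Real.pi, (starRingEnd ℂ) (γ θ) ^ a * f (γ θ, w) := by
      filter_upwards [Metric.ball_mem_nhds w₀ hδ] with w hw
      have hs : DifferentiableOn ℂ (fun u => f (u, w)) (Metric.ball 0 R) :=
        hf.slice fun u hu => ⟨hu, hw⟩
      rw [integral_conj_pow_mul_circleMap hs (by linarith : 0 < R / 2) (by linarith) a,
        ← mul_assoc, inv_mul_cancel₀, one_mul, sliceCoeff]
      have : ((R / 2 : ℝ) : ℂ) ≠ 0 := by exact_mod_cast (by linarith : R / 2 ≠ 0)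
      have hpi : (Real.pi : ℂ) ≠ 0 := by exact_mod_cast Real.pi_ne_zero
      exact mul_ne_zero (mul_ne_zero two_ne_zero hpi) (pow_ne_zero _ this)
    exact ((hmain.2.differentiableAt.const_mul _).congr_of_eventuallyEq heq)
  · filter_upwards [Metric.ball_mem_nhds w₀ hδ] with w hw
    exact (hcont w hw).aestronglyMeasurable
  · exact (hcont w₀ (Metric.mem_ball_self hδ)).intervalIntegrable _ _
  · refine Measurable.aestronglyMeasurable (Measurable.mul (by fun_prop) ?_)
    exact (measurable_fderiv_apply_const ℂ f ((0, 1) : ℂ × ℂ)).comp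
      (hγc.measurable.prodMk measurable_const)
  · refine ae_of_all _ fun θ _ w hw => ?_
    rw [norm_mul, norm_pow, RCLike.norm_conj, hγn]
    gcongr
    refine ((fderiv ℂ f (γ θ, w)).le_opNorm _).trans ?_
    simpa using hbd θ w hw
  · exact intervalIntegrable_const
  · refine ae_of_all _ fun θ _ w hw => ?_
    have hw' : w ∈ Metric.ball w₀ δ := Metric.ball_subset_ball (by linarith) hw
    have h1 : HasFDerivAt f (fderiv ℂ f (γ θ, w)) (γ θ, w) :=
      (hf.differentiableAt (hUo.mem_nhds (hγU θ w hw'))).hasFDerivAt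
    have h2 : HasDerivAt (fun w : ℂ => (γ θ, w)) (0, 1) w :=
      (hasDerivAt_const w (γ θ)).prodMk (hasDerivAt_id w)
    exact (h1.comp_hasDerivAt w h2).const_mul _

/-- Integration over a disc bundle of a function that is holomorphic in the fibres. -/
theorem setIntegral_discBundle {B : Set ℂ} (hB : MeasurableSet B) {ρ : ℂ → ℝ}
    (hρ : ∀ w ∈ B, 0 < ρ w) (hT : MeasurableSet {z : ℂ × ℂ | z.2 ∈ B ∧ ‖z.1‖ < ρ z.2})
    {f : ℂ × ℂ → ℂ} (hf : ∀ w ∈ B, DifferentiableOn ℂ (fun u => f (u, w)) (Metric.ball 0 (ρ w)))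
    (a : ℕ) (ψ : ℂ → ℂ)
    (hint : IntegrableOn (fun z => (starRingEnd ℂ) z.1 ^ a * (ψ z.2 * f z))
      {z : ℂ × ℂ | z.2 ∈ B ∧ ‖z.1‖ < ρ z.2}) :
    IntegrableOn (fun w => ((Real.pi * ρ w ^ (2 * a + 2) / (a + 1) : ℝ) : ℂ) *
        (ψ w * sliceCoeff a f w)) B ∧
      ∫ z in {z : ℂ × ℂ | z.2 ∈ B ∧ ‖z.1‖ < ρ z.2}, (starRingEnd ℂ) z.1 ^ a * (ψ z.2 * f z) =
        ∫ w in B, ((Real.pi * ρ w ^ (2 * a + 2) / (a + 1) : ℝ) : ℂ) *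
          (ψ w * sliceCoeff a f w) := by
  set T := {z : ℂ × ℂ | z.2 ∈ B ∧ ‖z.1‖ < ρ z.2} with hTdef
  set F : ℂ × ℂ → ℂ := T.indicator fun z => (starRingEnd ℂ) z.1 ^ a * (ψ z.2 * f z) with hF
  have hFint : Integrable F (volume.prod volume) := by
    rw [← Measure.volume_eq_prod]; exact hint.integrable_indicator hT
  have hin : ∀ w ∈ B, (fun u => F (u, w)) = (Metric.ball (0 : ℂ) (ρ w)).indicator
      fun u => (starRingEnd ℂ) u ^ a * (ψ w * f (u, w)) := fun w hw => by
    ext u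
    by_cases h : ‖u‖ < ρ w
    · rw [hF, Set.indicator_of_mem (show (u, w) ∈ T from ⟨hw, h⟩),
        Set.indicator_of_mem (by simpa using h)]
    · rw [hF, Set.indicator_of_notMem (show (u, w) ∉ T from fun h' => h h'.2),
        Set.indicator_of_notMem (by simpa using h)]
  have hout : ∀ w ∉ B, (fun u => F (u, w)) = fun _ => 0 := fun w hw => by
    ext u
    rw [hF, Set.indicator_of_notMem (show (u, w) ∉ T from fun h' => hw h'.1)]
  -- Fubini makes the fibre integrable only for almost every `w`, and the coefficient formula on the
  -- fibre disc needs that integrability.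
  have hae : ∀ᵐ w, ∫ u, F (u, w) = B.indicator (fun w =>
      ((Real.pi * ρ w ^ (2 * a + 2) / (a + 1) : ℝ) : ℂ) * (ψ w * sliceCoeff a f w)) w := by
    filter_upwards [hFint.prod_left_ae] with w hw
    by_cases hwB : w ∈ B
    · rw [hin w hwB, integrable_indicator_iff Metric.isOpen_ball.measurableSet] at hw
      rw [hin w hwB, integral_indicator Metric.isOpen_ball.measurableSet,
        Set.indicator_of_mem hwB]
      have h1 := setIntegral_ball_taylorCoeff (p := 0) (hρ w hwB) ((hf w hwB).const_mul (ψ w)) a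
        (by positivity) (by simpa using hw)
      simp only [Real.rpow_zero, Complex.ofReal_one, one_mul, zero_add, taylorCoeff_const_mul]
        at h1
      rw [h1, sliceCoeff]
      congr 2
      rw [show (2 * (a : ℝ) + 2) = ((2 * a + 2 : ℕ) : ℝ) by push_cast; ring, Real.rpow_natCast]
      push_cast
      have : (a : ℝ) + 1 ≠ 0 := by positivity
      field_simp
    · rw [hout w hwB, Set.indicator_of_notMem hwB, integral_zero]
  constructor
  · rw [← integrable_indicator_iff hB]
    exact hFint.integral_prod_right.congr hae
  · rw [← integral_indicator hT, Measure.volume_eq_prod, integral_prod_symm _ hFint,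
      integral_congr_ae hae, integral_indicator hB]

/-! ### Square-integrable holomorphic functions on polydiscs -/

/-- The mean value property: the case `k = 0`, `p = 0` of the coefficient formula after a
translation. -/
theorem setIntegral_ball_eq_center {G : ℂ → ℂ} {c : ℂ} {r : ℝ} (hr : 0 < r)
    (hG : DifferentiableOn ℂ G (Metric.ball c r)) (hint : IntegrableOn G (Metric.ball c r)) :
    ∫ z in Metric.ball c r, G z = ((Real.pi * r ^ 2 : ℝ) : ℂ) * G c := by
  have hpre : (fun u => c + u) ⁻¹' Metric.ball c r = Metric.ball 0 r := by
    ext u; simp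
  have hmp : MeasurePreserving (fun u : ℂ => c + u) volume volume :=
    measurePreserving_add_left volume c
  have hemb : MeasurableEmbedding (fun u : ℂ => c + u) := measurableEmbedding_addLeft c
  have hG' : DifferentiableOn ℂ (fun u => G (c + u)) (Metric.ball 0 r) :=
    hG.comp (by fun_prop) fun u hu => by simpa using hu
  have hint' : IntegrableOn (fun u => G (c + u)) (Metric.ball 0 r) := by
    rw [← hpre]; exact (hmp.integrableOn_comp_preimage hemb).2 hint
  rw [← hmp.setIntegral_preimage_emb hemb, hpre]
  have h := setIntegral_ball_taylorCoeff (p := 0) hr hG' 0 (by norm_num) (by simpa using hint')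
  simp only [Real.rpow_zero, Complex.ofReal_one, one_mul, pow_zero, Nat.cast_zero, mul_zero,
    add_zero, zero_add] at h
  rw [h]
  simp only [taylorCoeff, Nat.factorial_zero, Nat.cast_one, inv_one, one_mul, iteratedDeriv_zero,
    add_zero, Real.rpow_two]
  congr 2
  ring

theorem discBundle_const (R r : ℝ) (ζ : ℂ) :
    {z : ℂ × ℂ | z.2 ∈ Metric.ball ζ r ∧ ‖z.1‖ < R} = Metric.ball 0 R ×ˢ Metric.ball ζ r := by
  ext z
  simp [and_comm]

theorem volume_polydisc {R r : ℝ} (ζ : ℂ) (hR : 0 ≤ R) (hr : 0 ≤ r) :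
    volume (Metric.ball (0 : ℂ) R ×ˢ Metric.ball ζ r) =
      ENNReal.ofReal ((Real.pi * R * r) ^ 2) := by
  rw [Measure.volume_eq_prod, Measure.prod_prod, Complex.volume_ball, Complex.volume_ball,
    ← ENNReal.ofReal_coe_nnreal, NNReal.coe_real_pi, ← ENNReal.ofReal_pow hR,
    ← ENNReal.ofReal_pow hr, ← ENNReal.ofReal_mul (by positivity),
    ← ENNReal.ofReal_mul (by positivity), ← ENNReal.ofReal_mul (by positivity)]
  congr 1
  ring

/-- Integrate `conj z₁ ^ a * f` over the polydisc. The fibre formula and the mean value property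
give `π R^(2a+2) / (a+1) * π r²` times the coefficient at `ζ`, while Cauchy–Schwarz bounds the
integral by `R^a * (π R r) * ‖f‖`, with `π R r` the square root of the volume. -/
theorem norm_sliceCoeff_le {f : ℂ × ℂ → ℂ} {R r : ℝ} {ζ : ℂ} (hR : 0 < R) (hr : 0 < r)
    (hf : DifferentiableOn ℂ f (Metric.ball 0 R ×ˢ Metric.ball ζ r))
    (hL : MemLp f 2 (volume.restrict (Metric.ball 0 R ×ˢ Metric.ball ζ r))) (a : ℕ) :
    ‖sliceCoeff a f ζ‖ ≤ (a + 1) / (Real.pi * R ^ (a + 1) * r) *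
      (eLpNorm f 2 (volume.restrict (Metric.ball 0 R ×ˢ Metric.ball ζ r))).toReal := by
  set P := Metric.ball (0 : ℂ) R ×ˢ Metric.ball ζ r with hP
  have hPm : MeasurableSet P := (Metric.isOpen_ball.prod Metric.isOpen_ball).measurableSet
  have hvol := volume_polydisc ζ hR.le hr.le
  rw [← hP] at hvol
  have : IsFiniteMeasure (volume.restrict P) := ⟨by simp [hvol]⟩
  have hi : IntegrableOn f P := hL.integrable (by norm_num)
  have hnorm : ∀ z ∈ P, ‖(starRingEnd ℂ) z.1 ^ a * (1 * f z)‖ ≤ R ^ a * ‖f z‖ := fun z hz => by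
    rw [one_mul, norm_mul, norm_pow, RCLike.norm_conj]
    have h1 : ‖z.1‖ ≤ R := by simpa using (Metric.mem_ball.1 hz.1).le
    gcongr
  have hint : IntegrableOn (fun z => (starRingEnd ℂ) z.1 ^ a * (1 * f z)) P := by
    refine Integrable.mono' (hi.norm.const_mul (R ^ a)) ?_
      ((ae_restrict_mem hPm).mono hnorm)
    exact AEStronglyMeasurable.mul (by fun_prop) (by simpa using hi.1)
  have hdB := discBundle_const R r ζ
  have hmain := setIntegral_discBundle (B := Metric.ball ζ r) (ρ := fun _ => R)
    Metric.isOpen_ball.measurableSet (fun _ _ => hR) (by rw [hdB]; exact hPm)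
    (f := f) (fun w hw => hf.slice fun u hu => ⟨hu, hw⟩) a (fun _ => 1) (by rw [hdB]; exact hint)
  rw [hdB] at hmain
  simp only [one_mul] at hmain hint hnorm
  have hdiff : DifferentiableOn ℂ (sliceCoeff a f) (Metric.ball ζ r) := fun w hw => by
    obtain ⟨δ, hδ, hsub⟩ := Metric.isOpen_ball.mem_nhds hw |> Metric.mem_nhds_iff.1
    exact (differentiableAt_sliceCoeff hR hδ (hf.mono (Set.prod_mono subset_rfl hsub))
      a).differentiableWithinAt
  rw [setIntegral_ball_eq_center hr (hdiff.const_mul _) hmain.1] at hmain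
  have h1 : ‖∫ z in P, (starRingEnd ℂ) z.1 ^ a * f z‖ ≤ R ^ a * (Real.pi * R * r *
      (eLpNorm f 2 (volume.restrict P)).toReal) := by
    calc _ ≤ ∫ z in P, ‖(starRingEnd ℂ) z.1 ^ a * f z‖ := norm_integral_le_integral_norm _
      _ ≤ ∫ z in P, R ^ a * ‖f z‖ :=
        setIntegral_mono_on hint.norm (hi.norm.const_mul _) hPm hnorm
      _ = R ^ a * (eLpNorm f 1 (volume.restrict P)).toReal := by
        rw [integral_const_mul, integral_norm_eq_lintegral_enorm hi.1,
          eLpNorm_one_eq_lintegral_enorm]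
      _ ≤ _ := by
        gcongr
        have h2 := eLpNorm_le_eLpNorm_mul_rpow_measure_univ (p := 1) (q := 2)
          (by norm_num) hi.1
        rw [Measure.restrict_apply_univ, hvol, ENNReal.ofReal_rpow_of_nonneg (by positivity)
          (by norm_num)] at h2
        have h3 := ENNReal.toReal_mono (ENNReal.mul_ne_top hL.2.ne ENNReal.ofReal_ne_top) h2
        rw [ENNReal.toReal_mul, ENNReal.toReal_ofReal (by positivity)] at h3
        refine h3.trans_eq ?_
        rw [mul_comm]
        congr 1
        norm_num
        rw [← Real.sqrt_eq_rpow, Real.sqrt_sq (by positivity)]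
  rw [hmain.2, norm_mul, norm_mul, Complex.norm_real, Complex.norm_real,
    Real.norm_of_nonneg (by positivity), Real.norm_of_nonneg (by positivity)] at h1
  have hpi := Real.pi_pos
  have hk : 0 < Real.pi * r ^ 2 * (Real.pi * R ^ (2 * a + 2) / (a + 1)) := by positivity
  refine le_of_mul_le_mul_left (?_ : Real.pi * r ^ 2 * (Real.pi * R ^ (2 * a + 2) / (a + 1)) * _ ≤
    _ * _) hk
  calc _ = _ := by ring
    _ ≤ _ := h1
    _ = _ := by field_simp; ring

/-! ### Monomials on the Hartogs triangle -/

/-- The least `b : ℤ` for which `z₁ ^ a * z₂ ^ b` is square integrable on `hartogsTriangle γ`. -/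
noncomputable def lowExp (γ : ℝ) (a : ℕ) : ℤ := ⌊-(((a : ℝ) + 1) / γ)⌋

/-- The square-integrable monomials on `hartogsTriangle γ`, indexed by `ℕ × ℕ`. -/
noncomputable def hartogsMonomial (γ : ℝ) (α : ℕ × ℕ) (z : ℂ × ℂ) : ℂ :=
  z.1 ^ α.1 * z.2 ^ (lowExp γ α.1 + α.2)

/-- The number `b + 1 + (a + 1) / γ` attached to the monomial `z₁ ^ a * z₂ ^ b`. -/
noncomputable def hartogsWeight (γ : ℝ) (α : ℕ × ℕ) : ℝ :=
  lowExp γ α.1 + α.2 + 1 + ((α.1 : ℝ) + 1) / γ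

/-- The inverse of the squared norm of `hartogsMonomial γ α`. -/
noncomputable def hartogsCoeff (γ : ℝ) (α : ℕ × ℕ) : ℝ :=
  (α.1 + 1) * hartogsWeight γ α / Real.pi ^ 2

theorem hartogsWeight_pos (γ : ℝ) (α : ℕ × ℕ) : 0 < hartogsWeight γ α := by
  have h := Int.lt_floor_add_one (-(((α.1 : ℝ) + 1) / γ))
  have h2 : (0 : ℝ) ≤ α.2 := Nat.cast_nonneg _
  simp only [hartogsWeight, lowExp]
  linarith

theorem hartogsWeight_le (γ : ℝ) (α : ℕ × ℕ) : hartogsWeight γ α ≤ α.2 + 1 := by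
  have h := Int.floor_le (-(((α.1 : ℝ) + 1) / γ))
  simp only [hartogsWeight, lowExp]
  linarith

theorem hartogsCoeff_pos (γ : ℝ) (α : ℕ × ℕ) : 0 < hartogsCoeff γ α := by
  have := hartogsWeight_pos γ α
  have := Real.pi_pos
  unfold hartogsCoeff
  positivity

theorem hartogsCoeff_le (γ : ℝ) (α : ℕ × ℕ) : hartogsCoeff γ α ≤ (α.1 + 1) * (α.2 + 1) := by
  have h := hartogsWeight_le γ α
  have h1 : 1 ≤ Real.pi ^ 2 := by nlinarith [Real.pi_gt_three]
  rw [hartogsCoeff]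
  refine (div_le_self ?_ h1).trans (by gcongr)
  have := hartogsWeight_pos γ α
  positivity

theorem mem_hartogsTriangle_iff {γ : ℝ} (hγ : 0 < γ) (z : ℂ × ℂ) :
    z ∈ hartogsTriangle γ ↔
      z.2 ∈ {w : ℂ | 0 < ‖w‖ ∧ ‖w‖ < 1} ∧ ‖z.1‖ < ‖z.2‖ ^ γ⁻¹ := by
  rw [hartogsTriangle, Set.mem_ofPred_eq, Set.mem_ofPred_eq,
    Real.lt_rpow_inv_iff_of_pos (norm_nonneg _) (norm_nonneg _) hγ]
  constructor
  · rintro ⟨h1, h2⟩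
    exact ⟨⟨(Real.rpow_nonneg (norm_nonneg _) _).trans_lt h1, h2⟩, h1⟩
  · rintro ⟨⟨_, h2⟩, h1⟩
    exact ⟨h1, h2⟩

theorem hartogsTriangle_eq_discBundle {γ : ℝ} (hγ : 0 < γ) :
    hartogsTriangle γ =
      {z : ℂ × ℂ | z.2 ∈ {w : ℂ | 0 < ‖w‖ ∧ ‖w‖ < 1} ∧ ‖z.1‖ < ‖z.2‖ ^ γ⁻¹} :=
  Set.ext (mem_hartogsTriangle_iff hγ)

theorem isOpen_hartogsTriangle {γ : ℝ} (hγ : 0 < γ) : IsOpen (hartogsTriangle γ) := by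
  have h1 : Continuous fun z : ℂ × ℂ => ‖z.1‖ ^ γ :=
    continuous_fst.norm.rpow_const fun _ => Or.inr hγ.le
  exact (isOpen_lt h1 continuous_snd.norm).inter (isOpen_lt continuous_snd.norm continuous_const)

theorem measurableSet_hartogsTriangle {γ : ℝ} (hγ : 0 < γ) :
    MeasurableSet (hartogsTriangle γ) := (isOpen_hartogsTriangle hγ).measurableSet

theorem measurableSet_puncturedDisc : MeasurableSet {w : ℂ | 0 < ‖w‖ ∧ ‖w‖ < 1} :=
  ((isOpen_lt continuous_const continuous_norm).inter
    (isOpen_lt continuous_norm continuous_const)).measurableSet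

theorem snd_ne_zero_of_mem {γ : ℝ} (hγ : 0 < γ) {z : ℂ × ℂ} (hz : z ∈ hartogsTriangle γ) :
    z.2 ≠ 0 := norm_pos_iff.1 ((mem_hartogsTriangle_iff hγ z).1 hz).1.1

theorem differentiableOn_hartogsMonomial {γ : ℝ} (hγ : 0 < γ) (α : ℕ × ℕ) :
    DifferentiableOn ℂ (hartogsMonomial γ α) (hartogsTriangle γ) := fun z hz => by
  refine DifferentiableAt.differentiableWithinAt (DifferentiableAt.mul (by fun_prop) ?_)
  exact (differentiableAt_zpow.2 (Or.inl (snd_ne_zero_of_mem hγ hz))).comp z differentiableAt_snd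

/-- The fibre disc of radius `‖w‖ ^ γ⁻¹` contributes `π / (a + 1) * ‖w‖ ^ (2x - 2)`, with `x` the
weight, and the base integral of this power is `π / x`. -/
theorem lintegral_hartogsMonomial {γ : ℝ} (hγ : 0 < γ) (α : ℕ × ℕ) :
    ∫⁻ z in hartogsTriangle γ, ‖hartogsMonomial γ α z‖ₑ ^ 2 =
      ENNReal.ofReal (hartogsCoeff γ α)⁻¹ := by
  have hx := hartogsWeight_pos γ α
  set b : ℤ := lowExp γ α.1 + α.2 with hb
  set x := hartogsWeight γ α with hxdef
  set a := α.1 with ha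
  have hxb : x = b + 1 + (a + 1) / γ := by
    simp only [hxdef, hartogsWeight, hb]; push_cast; ring
  rw [← lintegral_indicator (measurableSet_hartogsTriangle hγ), Measure.volume_eq_prod,
    lintegral_prod_symm]
  swap
  · refine (Measurable.indicator ?_ (measurableSet_hartogsTriangle hγ)).aemeasurable
    unfold hartogsMonomial
    fun_prop
  have h1 : ∀ w : ℂ, ∫⁻ u, (hartogsTriangle γ).indicator
      (fun z => ‖hartogsMonomial γ α z‖ₑ ^ 2) (u, w) =
      {w : ℂ | 0 < ‖w‖ ∧ ‖w‖ < 1}.indicator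
        (fun w => ENNReal.ofReal (Real.pi / (a + 1)) * ENNReal.ofReal (‖w‖ ^ (2 * x - 2))) w := by
    intro w
    by_cases hw : w ∈ {w : ℂ | 0 < ‖w‖ ∧ ‖w‖ < 1}
    · have h2 : ∀ u, (hartogsTriangle γ).indicator
          (fun z => ‖hartogsMonomial γ α z‖ₑ ^ 2) (u, w) =
          (Metric.ball (0 : ℂ) (‖w‖ ^ γ⁻¹)).indicator (fun u =>
            ENNReal.ofReal (‖w‖ ^ (2 * b : ℝ)) * ENNReal.ofReal (‖u‖ ^ (2 * a : ℝ))) u := by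
        intro u
        by_cases hu : ‖u‖ < ‖w‖ ^ γ⁻¹
        · rw [Set.indicator_of_mem ((mem_hartogsTriangle_iff hγ (u, w)).2 ⟨hw, hu⟩),
            Set.indicator_of_mem (by simpa using hu), ← ENNReal.ofReal_mul (by positivity),
            ← ofReal_norm, ← ENNReal.ofReal_pow (by positivity)]
          congr 1
          rw [hartogsMonomial, norm_mul, norm_pow, norm_zpow, mul_pow, ← pow_mul,
            show (2 * a : ℝ) = ((a * 2 : ℕ) : ℝ) by push_cast; ring, Real.rpow_natCast,
            show (2 * b : ℝ) = ((b * 2 : ℤ) : ℝ) by push_cast; ring, Real.rpow_intCast,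
            zpow_mul, mul_comm]
          norm_cast
        · rw [Set.indicator_of_notMem (fun h => hu ((mem_hartogsTriangle_iff hγ (u, w)).1 h).2),
            Set.indicator_of_notMem (by simpa using hu)]
      simp only [h2]
      rw [lintegral_indicator Metric.isOpen_ball.measurableSet, lintegral_const_mul _ (by fun_prop),
        setLIntegral_ball_norm_rpow (by positivity) (by positivity), Set.indicator_of_mem hw,
        ← ENNReal.ofReal_mul (by positivity), ← ENNReal.ofReal_mul (by positivity)]
      congr 1
      rw [← Real.rpow_mul (norm_nonneg _), show 2 * x - 2 = 2 * b + γ⁻¹ * (2 * a + 2) by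
        rw [hxb]; field_simp; ring, Real.rpow_add hw.1]
      have : (a : ℝ) + 1 ≠ 0 := by positivity
      field_simp
    · rw [Set.indicator_of_notMem hw]
      have h2 : ∀ u, (hartogsTriangle γ).indicator
          (fun z => ‖hartogsMonomial γ α z‖ₑ ^ 2) (u, w) = 0 := fun u =>
        Set.indicator_of_notMem (fun h => hw ((mem_hartogsTriangle_iff hγ (u, w)).1 h).1) _
      simp [h2]
  simp only [h1]
  have h3 : ({w : ℂ | 0 < ‖w‖ ∧ ‖w‖ < 1} : Set ℂ) =ᵐ[volume] Metric.ball (0 : ℂ) 1 := by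
    have : {w : ℂ | 0 < ‖w‖ ∧ ‖w‖ < 1} = Metric.ball (0 : ℂ) 1 \ {0} := by
      ext w; simp [and_comm]
    rw [this]
    exact sdiff_null_ae_eq_self (by simp)
  rw [lintegral_indicator measurableSet_puncturedDisc, setLIntegral_congr h3,
    lintegral_const_mul _ (by fun_prop), setLIntegral_ball_norm_rpow zero_le_one (by linarith),
    ← ENNReal.ofReal_mul (by positivity)]
  congr 1
  rw [Real.one_rpow, hartogsCoeff, ← hxdef, ← ha, show 2 * x - 2 + 2 = 2 * x by ring]
  have : (a : ℝ) + 1 ≠ 0 := by positivity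
  have := hx.ne'
  field_simp

theorem eLpNorm_hartogsMonomial {γ : ℝ} (hγ : 0 < γ) (α : ℕ × ℕ) :
    eLpNorm (hartogsMonomial γ α) 2 (volume.restrict (hartogsTriangle γ)) =
      ENNReal.ofReal (√(hartogsCoeff γ α))⁻¹ := by
  have h0 := hartogsCoeff_pos γ α
  rw [eLpNorm_eq_lintegral_rpow_enorm_toReal (by norm_num) (by norm_num)]
  simp only [ENNReal.toReal_ofNat, ENNReal.rpow_ofNat]
  rw [lintegral_hartogsMonomial hγ, ENNReal.ofReal_rpow_of_pos (by positivity),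
    ← Real.sqrt_eq_rpow, Real.sqrt_inv]

theorem memBergmanSpace_hartogsMonomial {γ : ℝ} (hγ : 0 < γ) (α : ℕ × ℕ) :
    MemBergmanSpace (hartogsTriangle γ) (hartogsMonomial γ α) := by
  refine ⟨differentiableOn_hartogsMonomial hγ α, ?_, ?_⟩
  · exact (differentiableOn_hartogsMonomial hγ α).continuousOn.aestronglyMeasurable
      (measurableSet_hartogsTriangle hγ)
  · rw [eLpNorm_hartogsMonomial hγ]
    exact ENNReal.ofReal_lt_top

/-! ### Laurent coefficients of Bergman functions on the Hartogs triangle -/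

theorem polydisc_subset_hartogsTriangle {γ δ : ℝ} (hγ : 0 < γ) {ζ : ℂ} (h0 : 0 < ‖ζ‖)
    (h1 : δ ≤ ‖ζ‖ / 2) (h2 : ‖ζ‖ + δ ≤ 1) :
    Metric.ball (0 : ℂ) ((‖ζ‖ / 2) ^ γ⁻¹) ×ˢ Metric.ball ζ δ ⊆ hartogsTriangle γ := by
  rintro ⟨u, w⟩ ⟨hu, hw⟩
  rw [mem_ball_iff_norm] at hw
  rw [mem_ball_zero_iff] at hu
  have h3 : ‖ζ‖ / 2 < ‖w‖ := by
    linarith [norm_sub_norm_le ζ w, norm_sub_rev ζ w]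
  have h4 : ‖w‖ < 1 := by linarith [norm_sub_norm_le w ζ]
  refine (mem_hartogsTriangle_iff hγ _).2 ⟨⟨by simp only; linarith, h4⟩, hu.trans ?_⟩
  exact Real.rpow_lt_rpow (by positivity) h3 (inv_pos.2 hγ)

theorem differentiableOn_sliceCoeff_hartogs {γ : ℝ} (hγ : 0 < γ) {f : ℂ × ℂ → ℂ}
    (hf : DifferentiableOn ℂ f (hartogsTriangle γ)) (a : ℕ) :
    DifferentiableOn ℂ (sliceCoeff a f) {w : ℂ | 0 < ‖w‖ ∧ ‖w‖ < 1} := by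
  rintro w ⟨h0, h1⟩
  refine (differentiableAt_sliceCoeff (R := (‖w‖ / 2) ^ γ⁻¹) (δ := min (‖w‖ / 2) (1 - ‖w‖))
    (by positivity) (lt_min (by linarith) (by linarith)) (hf.mono ?_) a).differentiableWithinAt
  exact polydisc_subset_hartogsTriangle hγ h0 (min_le_left _ _)
    (by linarith [min_le_right (‖w‖ / 2) (1 - ‖w‖)])

/-- Apply `norm_sliceCoeff_le` on the polydisc of radii `r ^ γ⁻¹` and `r = ‖ζ‖ / 2`. The estimate
alone gives `O(ζ⁻¹)`; the `o` needed to remove the singularity comes from absolute continuity of the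
`L²` norm, as the polydisc shrinks to measure zero. -/
theorem isLittleO_sliceCoeff_hartogs {γ : ℝ} (hγ : 0 < γ) {f : ℂ × ℂ → ℂ}
    (hf : MemBergmanSpace (hartogsTriangle γ) f) (a : ℕ) {M : ℕ} (hM : ((a : ℝ) + 1) / γ ≤ M) :
    (fun ζ => ζ ^ M * sliceCoeff a f ζ) =o[𝓝[≠] (0 : ℂ)] fun ζ => ζ⁻¹ := by
  rw [Asymptotics.isLittleO_iff]
  intro c hc
  have hpi := Real.pi_pos
  -- All constants of the final estimate; the power of 2 comes from `‖ζ‖ = 2 * r`.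
  set K : ℝ := 2 ^ (M + 1) * (a + 1) / Real.pi with hK
  have hK0 : 0 < K := by positivity
  obtain ⟨δ, hδ, hsmall⟩ := hf.2.eLpNorm_indicator_le (by norm_num) (by norm_num)
    (div_pos hc hK0)
  -- This is the volume of the polydisc with its first radius replaced by the bound 1.
  have hev : ∀ᶠ ζ : ℂ in 𝓝 0, (Real.pi * 1 * (‖ζ‖ / 2)) ^ 2 < δ := by
    have : Continuous fun ζ : ℂ => (Real.pi * 1 * (‖ζ‖ / 2)) ^ 2 := by fun_prop
    refine this.continuousAt.eventually (gt_mem_nhds ?_)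
    simpa using hδ
  filter_upwards [self_mem_nhdsWithin, nhdsWithin_le_nhds hev,
    nhdsWithin_le_nhds (Metric.ball_mem_nhds (0 : ℂ) (by norm_num : (0 : ℝ) < 1 / 2))]
    with ζ hne hζδ hζ
  have h0 : 0 < ‖ζ‖ := norm_pos_iff.2 hne
  rw [mem_ball_zero_iff] at hζ
  set R := (‖ζ‖ / 2) ^ γ⁻¹ with hR
  set r := ‖ζ‖ / 2 with hr
  have hr0 : 0 < r := by positivity
  have hR0 : 0 < R := by positivity
  have hR1 : R ≤ 1 := Real.rpow_le_one hr0.le (by linarith) (inv_pos.2 hγ).le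
  have hsub := polydisc_subset_hartogsTriangle (δ := r) hγ h0 le_rfl (by linarith)
  rw [← hr, ← hR] at hsub
  set P := Metric.ball (0 : ℂ) R ×ˢ Metric.ball ζ r with hP
  have hPm : MeasurableSet P := (Metric.isOpen_ball.prod Metric.isOpen_ball).measurableSet
  have hbound := norm_sliceCoeff_le hR0 hr0 (hf.1.mono hsub)
    (hf.2.mono_measure (Measure.restrict_mono hsub le_rfl)) a
  have hN : (eLpNorm f 2 (volume.restrict P)).toReal ≤ c / K := by
    have h1 := hsmall P hPm (by
      rw [Measure.restrict_apply hPm, Set.inter_eq_left.2 hsub, hP,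
        volume_polydisc ζ hR0.le hr0.le]
      refine ENNReal.ofReal_le_ofReal (le_trans ?_ hζδ.le)
      gcongr)
    rw [eLpNorm_indicator_eq_eLpNorm_restrict hPm, Measure.restrict_restrict hPm,
      Set.inter_eq_left.2 hsub] at h1
    exact ENNReal.toReal_le_of_le_ofReal (by positivity) h1
  have hRa : r ^ M ≤ R ^ (a + 1) := by
    rw [hR, ← Real.rpow_natCast, ← Real.rpow_natCast, ← Real.rpow_mul hr0.le]
    refine Real.rpow_le_rpow_of_exponent_ge hr0 (by linarith) ?_
    calc γ⁻¹ * ((a + 1 : ℕ) : ℝ) = ((a : ℝ) + 1) / γ := by push_cast; ring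
      _ ≤ M := hM
  rw [norm_mul, norm_pow, norm_inv]
  have hζr : ‖ζ‖ = 2 * r := by rw [hr]; ring
  calc ‖ζ‖ ^ M * ‖sliceCoeff a f ζ‖
      ≤ ‖ζ‖ ^ M * ((a + 1) / (Real.pi * R ^ (a + 1) * r) * (c / K)) := by
        gcongr
        exact hbound.trans (by gcongr)
    _ ≤ ‖ζ‖ ^ M * ((a + 1) / (Real.pi * r ^ M * r) * (c / K)) := by gcongr
    _ = c * ‖ζ‖⁻¹ := by
      rw [hK, hζr, mul_pow, pow_succ]
      field_simp

/-- The Laurent coefficients of a Bergman function are obtained by integrating it against the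
square-integrable monomials, and no other monomials occur. -/
theorem exists_laurentCoeff {γ : ℝ} (hγ : 0 < γ) {f : ℂ × ℂ → ℂ}
    (hf : MemBergmanSpace (hartogsTriangle γ) f) (a : ℕ) :
    ∃ c : ℕ → ℂ,
      (∀ ζ : ℂ, 0 < ‖ζ‖ → ‖ζ‖ < 1 →
        HasSum (fun i : ℕ => c i * ζ ^ (lowExp γ a + i)) (sliceCoeff a f ζ)) ∧
      ∀ i : ℕ, ∫ z in hartogsTriangle γ, (starRingEnd ℂ) (hartogsMonomial γ (a, i) z) * f z =
        ((hartogsCoeff γ (a, i))⁻¹ : ℝ) * c i := by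
  have hlow : lowExp γ a < 0 := by
    refine Int.floor_lt.2 ?_
    have : 0 < ((a : ℝ) + 1) / γ := by positivity
    push_cast
    linarith
  obtain ⟨M, hMlow⟩ : ∃ M : ℕ, lowExp γ a = -(M : ℤ) := ⟨(-lowExp γ a).toNat, by omega⟩
  have hM0 : M ≠ 0 := by rintro rfl; simp [hMlow] at hlow
  have hM : ((a : ℝ) + 1) / γ ≤ M := by
    have h := Int.floor_le (-(((a : ℝ) + 1) / γ))
    rw [← lowExp, hMlow] at h
    push_cast at h
    linarith
  set D := {w : ℂ | 0 < ‖w‖ ∧ ‖w‖ < 1} with hD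
  have hDball : D = Metric.ball (0 : ℂ) 1 \ {0} := by
    ext w; simp [hD, and_comm]
  set g : ℂ → ℂ := fun ζ => ζ ^ M * sliceCoeff a f ζ with hg
  have hgd : DifferentiableOn ℂ g (Metric.ball 0 1 \ {0}) := by
    rw [← hDball]
    exact DifferentiableOn.mul (by fun_prop) (differentiableOn_sliceCoeff_hartogs hγ hf.1 a)
  set G := Function.update g 0 (limUnder (𝓝[≠] 0) g) with hG
  have hGd : DifferentiableOn ℂ G (Metric.ball 0 1) := by
    refine Complex.differentiableOn_update_limUnder_of_isLittleO
      (Metric.ball_mem_nhds _ one_pos) hgd ?_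
    -- The removability criterion concerns `g - g 0`; here `M ≠ 0` makes the junk value at the
    -- origin vanish.
    have hg0 : g 0 = 0 := by simp [hg, hM0]
    simpa [hg0] using isLittleO_sliceCoeff_hartogs hγ hf a hM
  have hGg : ∀ w ∈ D, G w = w ^ M * sliceCoeff a f w := fun w hw => by
    rw [hG, Function.update_of_ne (norm_pos_iff.1 hw.1)]
  refine ⟨fun k => taylorCoeff k G, fun ζ h0 h1 => ?_, fun i => ?_⟩
  · have h2 := (hasSum_taylorCoeff hGd (by simpa using h1 : ζ ∈ Metric.ball 0 1)).mul_left
      (ζ ^ (-(M : ℤ)))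
    have hζ : ζ ≠ 0 := norm_pos_iff.1 h0
    rw [hGg ζ ⟨h0, h1⟩, ← mul_assoc, zpow_neg, zpow_natCast,
      inv_mul_cancel₀ (pow_ne_zero _ hζ), one_mul] at h2
    refine h2.congr_fun fun k => ?_
    rw [hMlow, zpow_add₀ hζ, zpow_neg, zpow_natCast, zpow_natCast]
    ring
  · set x := hartogsWeight γ (a, i) with hx
    have hx0 : 0 < x := hartogsWeight_pos γ _
    set ψ : ℂ → ℂ := fun w => (starRingEnd ℂ) (w ^ (lowExp γ a + i)) with hψ
    -- The fibre gives `‖w‖ ^ (γ⁻¹ (2a + 2))`; the factors `conj w ^ (-M)` from the monomial and `w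
    -- ^ (-M)` from `sliceCoeff` give `‖w‖ ^ (-2M)`.
    set p : ℝ := γ⁻¹ * (2 * a + 2) - 2 * M with hp
    have hpx : p + 2 * i + 2 = 2 * x := by
      simp only [hp, hx, hartogsWeight, hMlow]; push_cast; field_simp; ring
    have hT := hartogsTriangle_eq_discBundle hγ
    have hfun : ∀ z : ℂ × ℂ, (starRingEnd ℂ) (hartogsMonomial γ (a, i) z) * f z =
        (starRingEnd ℂ) z.1 ^ a * (ψ z.2 * f z) := fun z => by
      simp only [hartogsMonomial, hψ, map_mul, map_pow]; ring
    have hint : IntegrableOn (fun z => (starRingEnd ℂ) z.1 ^ a * (ψ z.2 * f z))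
        (hartogsTriangle γ) := by
      have h1 : MemLp (fun z => (starRingEnd ℂ) (hartogsMonomial γ (a, i) z)) 2
          (volume.restrict (hartogsTriangle γ)) :=
        (memBergmanSpace_hartogsMonomial hγ (a, i)).2.star
      exact (h1.integrable_mul hf.2).congr (ae_of_all _ hfun)
    have hmain := setIntegral_discBundle (B := D) (ρ := fun w => ‖w‖ ^ γ⁻¹)
      measurableSet_puncturedDisc (fun w hw => Real.rpow_pos_of_pos hw.1 _)
      (by rw [← hT]; exact measurableSet_hartogsTriangle hγ) (f := f)
      (fun w hw => hf.1.slice fun u hu => by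
        rw [hT]; exact ⟨hw, by simpa using hu⟩) a ψ (by rw [← hT]; exact hint)
    rw [← hT] at hmain
    simp only [hfun]
    have hDae : D =ᵐ[volume] Metric.ball (0 : ℂ) 1 := by
      rw [hDball]; exact sdiff_null_ae_eq_self (by simp)
    have hcongr : ∀ w ∈ D, ((Real.pi * (‖w‖ ^ γ⁻¹) ^ (2 * a + 2) / (a + 1) : ℝ) : ℂ) *
        (ψ w * sliceCoeff a f w) = ((Real.pi / (a + 1) : ℝ) : ℂ) *
          (((‖w‖ ^ p : ℝ) : ℂ) * (starRingEnd ℂ) w ^ i * G w) := fun w hw => by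
      have hw0 : w ≠ 0 := norm_pos_iff.1 hw.1
      have hc0 : (starRingEnd ℂ) w ≠ 0 := (_root_.map_ne_zero _).2 hw0
      have hn : (starRingEnd ℂ) w * w = ((‖w‖ ^ 2 : ℝ) : ℂ) := by
        rw [mul_comm, Complex.mul_conj, Complex.normSq_eq_norm_sq]
      have hpw : (‖w‖ ^ γ⁻¹) ^ (2 * a + 2) = ‖w‖ ^ p * (‖w‖ ^ 2) ^ M := by
        rw [← Real.rpow_natCast, ← Real.rpow_mul hw.1.le, ← pow_mul, ← Real.rpow_natCast,
          ← Real.rpow_add hw.1]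
        congr 1
        rw [hp]; push_cast; ring
      rw [hGg w hw, hpw, hψ]
      simp only [hMlow, map_zpow₀]
      rw [zpow_add₀ hc0, zpow_neg, zpow_natCast, zpow_natCast]
      push_cast
      rw [Complex.ofReal_pow] at hn
      rw [← hn, mul_pow]
      field_simp
    have hint2 : IntegrableOn (fun w => ((Real.pi / (a + 1) : ℝ) : ℂ) *
          (((‖w‖ ^ p : ℝ) : ℂ) * (starRingEnd ℂ) w ^ i * G w)) (Metric.ball 0 1) :=
      (hmain.1.congr_fun hcongr measurableSet_puncturedDisc).congr_set_ae hDae.symm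
    have hk : ((Real.pi / (a + 1) : ℝ) : ℂ) ≠ 0 := by
      exact_mod_cast (by have := Real.pi_pos; positivity : Real.pi / (a + 1) ≠ 0)
    have hint3 : IntegrableOn (fun w => ((‖w‖ ^ p : ℝ) : ℂ) * (starRingEnd ℂ) w ^ i * G w)
        (Metric.ball 0 1) := by
      refine (hint2.const_mul (((Real.pi / (a + 1) : ℝ) : ℂ))⁻¹).congr (ae_of_all _ fun w => ?_)
      simp only
      rw [inv_mul_cancel_left₀ hk]
    rw [hmain.2, setIntegral_congr_fun measurableSet_puncturedDisc hcongr,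
      setIntegral_congr_set hDae, integral_const_mul,
      setIntegral_ball_taylorCoeff one_pos hGd i (by rw [hpx]; linarith) hint3, hpx,
      ← mul_assoc, ← Complex.ofReal_mul]
    congr 2
    rw [Real.one_rpow, hartogsCoeff, ← hx]
    field_simp

/-! ### Series of holomorphic and of square-integrable functions -/

/-- By Cauchy's estimate on balls of half the radius, the summable bounds pass to the derivatives,
so the series may be differentiated termwise. -/
theorem differentiableOn_tsum_of_locally_summable {ι E F : Type*} [NormedAddCommGroup E]
    [NormedSpace ℂ E] [NormedAddCommGroup F] [NormedSpace ℂ F] [CompleteSpace F]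
    {u : ι → E → F} {U : Set E} (hu : ∀ i, DifferentiableOn ℂ (u i) U)
    (hb : ∀ x ∈ U, ∃ b : ι → ℝ, Summable b ∧ ∀ᶠ y in 𝓝 x, y ∈ U ∧ ∀ i, ‖u i y‖ ≤ b i) :
    DifferentiableOn ℂ (fun x => ∑' i, u i x) U := fun x hx => by
  obtain ⟨b, hbs, hev⟩ := hb x hx
  obtain ⟨r, hr, hball⟩ := Metric.eventually_nhds_iff_ball.1 hev
  have hsub : ∀ y ∈ Metric.ball x (r / 2), Metric.ball y (r / 2) ⊆ Metric.ball x r :=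
    fun y hy z hz => by
      rw [Metric.mem_ball] at *
      linarith [dist_triangle z y x]
  refine (hasFDerivAt_tsum_of_isPreconnected (f' := fun i y => fderiv ℂ (u i) y)
    (u := fun i => 2 * b i / (r / 2)) (s := Metric.ball x (r / 2)) (x₀ := x) ?_
    Metric.isOpen_ball (convex_ball x _).isPreconnected ?_ ?_
    (Metric.mem_ball_self (by linarith)) ?_
    (Metric.mem_ball_self (by linarith))).differentiableAt.differentiableWithinAt
  · exact (hbs.mul_left 2).div_const _
  · intro i y hy
    refine ((hu i).differentiableAt (mem_of_superset (Metric.ball_mem_nhds y (half_pos hr))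
      fun z hz => (hball z (hsub y hy hz)).1)).hasFDerivAt
  · exact fun i y hy => norm_fderiv_le_of_norm_le (half_pos hr)
      ((hu i).mono fun z hz => (hball z (hsub y hy hz)).1)
      fun z hz => (hball z (hsub y hy hz)).2 i
  · exact Summable.of_norm_bounded hbs (hball x (Metric.mem_ball_self hr)).2

/-- Enumerate the indices and apply Fatou to the partial sums, whose norms are at most `∑ b`. -/
theorem memLp_of_hasSum {ι X E : Type*} [Denumerable ι] [MeasurableSpace X] {μ : Measure X}
    [NormedAddCommGroup E] {p : ENNReal} (hp : 1 ≤ p) {u : ι → X → E} {g : X → E} {b : ι → ℝ}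
    (hu : ∀ i, AEStronglyMeasurable (u i) μ) (hb : Summable b) (hb0 : ∀ i, 0 ≤ b i)
    (hub : ∀ i, eLpNorm (u i) p μ ≤ ENNReal.ofReal (b i))
    (hg : ∀ᵐ x ∂μ, HasSum (fun i => u i x) (g x)) : MemLp g p μ := by
  set e := (Denumerable.eqv ι).symm with he
  have hlim : ∀ᵐ x ∂μ, Tendsto (fun n => (∑ k ∈ Finset.range n, u (e k)) x) atTop (𝓝 (g x)) := by
    filter_upwards [hg] with x hx
    simpa using ((e.hasSum_iff (f := fun i => u i x)).2 hx).tendsto_sum_nat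
  have hm : ∀ n, AEStronglyMeasurable (∑ k ∈ Finset.range n, u (e k)) μ := fun n =>
    Finset.aestronglyMeasurable_sum _ fun k _ => hu _
  refine ⟨aestronglyMeasurable_of_tendsto_ae _ hm hlim, ?_⟩
  refine (Lp.eLpNorm_lim_le_liminf_eLpNorm hm g hlim).trans_lt ?_
  refine lt_of_le_of_lt ?_ (ENNReal.ofReal_lt_top (r := ∑' i, b i))
  refine liminf_le_of_le (by isBoundedDefault) fun c hc => ?_
  obtain ⟨n, hn⟩ := hc.exists
  refine hn.trans ((eLpNorm_sum_le (fun k _ => hu _) hp).trans ?_)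
  refine (Finset.sum_le_sum fun k _ => hub (e k)).trans ?_
  rw [← ENNReal.ofReal_sum_of_nonneg fun k _ => hb0 _]
  refine ENNReal.ofReal_le_ofReal ?_
  rw [← e.tsum_eq]
  exact ((e.summable_iff).2 hb).sum_le_tsum _ fun k _ => hb0 _

theorem integral_norm_mul_le_eLpNorm {X : Type*} [MeasurableSpace X] {μ : Measure X}
    {f g : X → ℂ} (hf : MemLp f 2 μ) (hg : MemLp g 2 μ) :
    ∫ x, ‖f x * g x‖ ∂μ ≤ (eLpNorm f 2 μ).toReal * (eLpNorm g 2 μ).toReal := by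
  have h1 : AEStronglyMeasurable (fun x => f x * g x) μ := hf.1.mul hg.1
  have h2 : eLpNorm (f • g) 1 μ ≤ eLpNorm f 2 μ * eLpNorm g 2 μ :=
    eLpNorm_smul_le_mul_eLpNorm hg.1 hf.1
  rw [integral_norm_eq_lintegral_enorm h1, ← eLpNorm_one_eq_lintegral_enorm, ← ENNReal.toReal_mul]
  exact ENNReal.toReal_mono (ENNReal.mul_ne_top hf.2.ne hg.2.ne) h2

/-! ### The Bergman kernel of the Hartogs triangle -/

theorem summable_succ_mul_pow {r : ℝ} (h0 : 0 ≤ r) (h1 : r < 1) :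
    Summable fun n : ℕ => ((n : ℝ) + 1) * r ^ n := by
  have h := summable_pow_mul_geometric_of_norm_lt_one 1
    (by rwa [Real.norm_of_nonneg h0] : ‖r‖ < 1)
  refine (h.add (summable_geometric_of_lt_one h0 h1)).congr fun n => ?_
  ring

theorem summable_majorant {ρ τ : ℝ} (hρ0 : 0 ≤ ρ) (hρ : ρ < 1) (hτ0 : 0 ≤ τ) (hτ : τ < 1)
    (C : ℝ) :
    Summable fun α : ℕ × ℕ => ((α.1 : ℝ) + 1) * (α.2 + 1) * (C * ρ ^ α.1 * τ ^ α.2) := by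
  have h := (summable_succ_mul_pow hρ0 hρ).mul_of_nonneg (summable_succ_mul_pow hτ0 hτ)
    (fun n => by positivity) (fun n => by positivity)
  refine (h.mul_left C).congr fun α => ?_
  ring

/-- Dropping the floor costs at most one power of `z₂` and leaves a double geometric series with
both ratios below 1 on the domain. -/
theorem norm_hartogsMonomial_le {γ : ℝ} (hγ : 0 < γ) {z : ℂ × ℂ} (hz : z ∈ hartogsTriangle γ)
    (α : ℕ × ℕ) :
    ‖hartogsMonomial γ α z‖ ≤
      ‖z.2‖ ^ (-1 - γ⁻¹) * (‖z.1‖ / ‖z.2‖ ^ γ⁻¹) ^ α.1 * ‖z.2‖ ^ α.2 := by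
  obtain ⟨⟨h0, h1⟩, -⟩ := (mem_hartogsTriangle_iff hγ z).1 hz
  have hz0 : z.2 ≠ 0 := norm_pos_iff.1 h0
  have hlow : -1 - γ⁻¹ - γ⁻¹ * α.1 ≤ lowExp γ α.1 := by
    have h := (Int.lt_floor_add_one (-(((α.1 : ℝ) + 1) / γ))).le
    rw [← lowExp] at h
    have h' : -(((α.1 : ℝ) + 1) / γ) = -γ⁻¹ - γ⁻¹ * α.1 := by field_simp; ring
    linarith
  have h2 : ‖z.2‖ ^ lowExp γ α.1 ≤ ‖z.2‖ ^ (-1 - γ⁻¹) / (‖z.2‖ ^ γ⁻¹) ^ α.1 := by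
    rw [← Real.rpow_natCast, ← Real.rpow_mul h0.le, ← Real.rpow_sub h0, ← Real.rpow_intCast]
    exact Real.rpow_le_rpow_of_exponent_ge h0 h1.le hlow
  rw [hartogsMonomial, norm_mul, norm_pow, zpow_add₀ hz0, norm_mul, norm_zpow, zpow_natCast,
    norm_pow]
  calc ‖z.1‖ ^ α.1 * (‖z.2‖ ^ lowExp γ α.1 * ‖z.2‖ ^ α.2)
      ≤ ‖z.1‖ ^ α.1 * (‖z.2‖ ^ (-1 - γ⁻¹) / (‖z.2‖ ^ γ⁻¹) ^ α.1 * ‖z.2‖ ^ α.2) := by gcongr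
    _ = _ := by rw [div_pow]; ring

theorem exists_local_majorant {γ : ℝ} (hγ : 0 < γ) {z₀ : ℂ × ℂ} (hz₀ : z₀ ∈ hartogsTriangle γ) :
    ∃ C ρ τ : ℝ, 0 ≤ C ∧ 0 ≤ ρ ∧ ρ < 1 ∧ 0 ≤ τ ∧ τ < 1 ∧
      ∀ᶠ z in 𝓝 z₀, z ∈ hartogsTriangle γ ∧
        ∀ α, ‖hartogsMonomial γ α z‖ ≤ C * ρ ^ α.1 * τ ^ α.2 := by
  obtain ⟨⟨h0, h1⟩, h2⟩ := (mem_hartogsTriangle_iff hγ z₀).1 hz₀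
  have hR0 : 0 < ‖z₀.2‖ ^ γ⁻¹ := Real.rpow_pos_of_pos h0 _
  obtain ⟨ρ, hρ, hρ1⟩ := exists_between ((div_lt_one hR0).2 h2)
  obtain ⟨τ, hτ, hτ1⟩ := exists_between h1
  have hc1 : ContinuousAt (fun z : ℂ × ℂ => ‖z.2‖ ^ γ⁻¹) z₀ :=
    continuous_snd.norm.continuousAt.rpow_const (Or.inl h0.ne')
  have hc2 : ContinuousAt (fun z : ℂ × ℂ => ‖z.2‖ ^ (-1 - γ⁻¹)) z₀ :=
    continuous_snd.norm.continuousAt.rpow_const (Or.inl h0.ne')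
  have hc3 : ContinuousAt (fun z : ℂ × ℂ => ‖z.1‖ / ‖z.2‖ ^ γ⁻¹) z₀ :=
    continuous_fst.norm.continuousAt.div hc1 hR0.ne'
  have hρ0 : 0 ≤ ρ := le_trans (by positivity) hρ.le
  refine ⟨‖z₀.2‖ ^ (-1 - γ⁻¹) + 1, ρ, τ, by positivity, hρ0, hρ1,
    h0.le.trans hτ.le, hτ1, ?_⟩
  filter_upwards [(isOpen_hartogsTriangle hγ).mem_nhds hz₀,
    hc2.eventually (gt_mem_nhds (lt_add_one _)), hc3.eventually (gt_mem_nhds hρ),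
    continuous_snd.norm.continuousAt.eventually (gt_mem_nhds hτ)] with z hz hz2 hz3 hz4
  refine ⟨hz, fun α => (norm_hartogsMonomial_le hγ hz α).trans ?_⟩
  gcongr

theorem exists_majorant {γ : ℝ} (hγ : 0 < γ) {z : ℂ × ℂ} (hz : z ∈ hartogsTriangle γ) :
    ∃ C ρ τ : ℝ, 0 ≤ C ∧ 0 ≤ ρ ∧ ρ < 1 ∧ 0 ≤ τ ∧ τ < 1 ∧
      ∀ α, ‖hartogsMonomial γ α z‖ ≤ C * ρ ^ α.1 * τ ^ α.2 := by
  obtain ⟨C, ρ, τ, hC, h1, h2, h3, h4, hev⟩ := exists_local_majorant hγ hz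
  exact ⟨C, ρ, τ, hC, h1, h2, h3, h4, hev.self_of_nhds.2⟩

theorem summable_norm_hartogsMonomial {γ : ℝ} (hγ : 0 < γ) {z : ℂ × ℂ}
    (hz : z ∈ hartogsTriangle γ) :
    Summable fun α : ℕ × ℕ => ((α.1 : ℝ) + 1) * (α.2 + 1) * ‖hartogsMonomial γ α z‖ := by
  obtain ⟨C, ρ, τ, hC, h1, h2, h3, h4, hb⟩ := exists_majorant hγ hz
  refine Summable.of_nonneg_of_le (fun α => by positivity) (fun α => ?_)
    (summable_majorant h1 h2 h3 h4 C)
  gcongr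
  exact hb α

theorem exists_norm_hartogsMonomial_le {γ : ℝ} (hγ : 0 < γ) {z : ℂ × ℂ}
    (hz : z ∈ hartogsTriangle γ) : ∃ C, 0 ≤ C ∧ ∀ α, ‖hartogsMonomial γ α z‖ ≤ C := by
  obtain ⟨C, ρ, τ, hC, h1, h2, h3, h4, hb⟩ := exists_majorant hγ hz
  refine ⟨C, hC, fun α => (hb α).trans ?_⟩
  calc C * ρ ^ α.1 * τ ^ α.2 ≤ C * 1 * 1 := by
        gcongr
        · exact pow_le_one₀ h1 h2.le
        · exact pow_le_one₀ h3 h4.le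
    _ = C := by ring

/-- A monomial has norm `k ^ (-1/2)`, with `k` its `hartogsCoeff`, so `L²` bounds on kernel terms
involve `√k`. -/
theorem sqrt_hartogsCoeff_le (γ : ℝ) (α : ℕ × ℕ) :
    √(hartogsCoeff γ α) ≤ ((α.1 : ℝ) + 1) * (α.2 + 1) := by
  have h1 : (1 : ℝ) ≤ ((α.1 : ℝ) + 1) * (α.2 + 1) := by
    have h2 : (0 : ℝ) ≤ α.1 := Nat.cast_nonneg _
    have h3 : (0 : ℝ) ≤ α.2 := Nat.cast_nonneg _
    nlinarith
  refine Real.sqrt_le_iff.2 ⟨by positivity, (hartogsCoeff_le γ α).trans ?_⟩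
  nlinarith

/-- The Bergman kernel of the Hartogs triangle as a series of monomials. -/
noncomputable def hartogsKernel (γ : ℝ) (z w : ℂ × ℂ) : ℂ :=
  ∑' α : ℕ × ℕ, (hartogsCoeff γ α : ℂ) * hartogsMonomial γ α z *
    (starRingEnd ℂ) (hartogsMonomial γ α w)

theorem norm_hartogsKernel_term_le (γ : ℝ) (α : ℕ × ℕ) (z w : ℂ × ℂ) :
    ‖(hartogsCoeff γ α : ℂ) * hartogsMonomial γ α z * (starRingEnd ℂ) (hartogsMonomial γ α w)‖ ≤
      ((α.1 : ℝ) + 1) * (α.2 + 1) * ‖hartogsMonomial γ α z‖ * ‖hartogsMonomial γ α w‖ := by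
  rw [norm_mul, norm_mul, RCLike.norm_conj, Complex.norm_real,
    Real.norm_of_nonneg (hartogsCoeff_pos γ α).le]
  gcongr
  exact hartogsCoeff_le γ α

theorem hasSum_hartogsKernel {γ : ℝ} (hγ : 0 < γ) {z w : ℂ × ℂ} (hz : z ∈ hartogsTriangle γ)
    (hw : w ∈ hartogsTriangle γ) :
    HasSum (fun α => (hartogsCoeff γ α : ℂ) * hartogsMonomial γ α z *
      (starRingEnd ℂ) (hartogsMonomial γ α w)) (hartogsKernel γ z w) := by
  obtain ⟨C, hC, hwC⟩ := exists_norm_hartogsMonomial_le hγ hw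
  refine (Summable.of_norm_bounded ((summable_norm_hartogsMonomial hγ hz).mul_right C)
    fun α => (norm_hartogsKernel_term_le γ α z w).trans ?_).hasSum
  gcongr
  exact hwC α

theorem memBergmanSpace_hartogsKernel {γ : ℝ} (hγ : 0 < γ) {w : ℂ × ℂ}
    (hw : w ∈ hartogsTriangle γ) :
    MemBergmanSpace (hartogsTriangle γ) fun z => hartogsKernel γ z w := by
  have hd : ∀ α, DifferentiableOn ℂ (fun z => (hartogsCoeff γ α : ℂ) * hartogsMonomial γ α z *
      (starRingEnd ℂ) (hartogsMonomial γ α w)) (hartogsTriangle γ) := fun α =>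
    ((differentiableOn_hartogsMonomial hγ α).const_mul _).mul_const _
  constructor
  · refine differentiableOn_tsum_of_locally_summable hd fun z hz => ?_
    obtain ⟨C, ρ, τ, hC, h1, h2, h3, h4, hev⟩ := exists_local_majorant hγ hz
    obtain ⟨C', hC', hwC⟩ := exists_norm_hartogsMonomial_le hγ hw
    refine ⟨_, (summable_majorant h1 h2 h3 h4 C).mul_right C', hev.mono fun y hy =>
      ⟨hy.1, fun α => (norm_hartogsKernel_term_le γ α y w).trans ?_⟩⟩
    gcongr
    · exact hy.2 α
    · exact hwC α
  · refine memLp_of_hasSum (by norm_num)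
      (fun α => (hd α).continuousOn.aestronglyMeasurable (measurableSet_hartogsTriangle hγ))
      (summable_norm_hartogsMonomial hγ hw) (fun α => by positivity) (fun α => ?_)
      ((ae_restrict_mem (measurableSet_hartogsTriangle hγ)).mono fun z hz =>
        hasSum_hartogsKernel hγ hz hw)
    have h0 := hartogsCoeff_pos γ α
    have heq : (fun z => (hartogsCoeff γ α : ℂ) * hartogsMonomial γ α z *
        (starRingEnd ℂ) (hartogsMonomial γ α w)) =
        ((hartogsCoeff γ α : ℂ) * (starRingEnd ℂ) (hartogsMonomial γ α w)) •
          hartogsMonomial γ α := by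
      ext z; simp only [Pi.smul_apply, smul_eq_mul]; ring
    rw [heq, eLpNorm_const_smul, eLpNorm_hartogsMonomial hγ, ← ofReal_norm,
      ← ENNReal.ofReal_mul (norm_nonneg _)]
    refine ENNReal.ofReal_le_ofReal ?_
    rw [norm_mul, RCLike.norm_conj, Complex.norm_real, Real.norm_of_nonneg h0.le]
    calc hartogsCoeff γ α * ‖hartogsMonomial γ α w‖ * (√(hartogsCoeff γ α))⁻¹
        = (hartogsCoeff γ α / √(hartogsCoeff γ α)) * ‖hartogsMonomial γ α w‖ := by ring
      _ ≤ _ := by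
        rw [Real.div_sqrt]
        gcongr
        exact sqrt_hartogsCoeff_le γ α

theorem hartogsKernel_conj_symm (γ : ℝ) (z w : ℂ × ℂ) :
    hartogsKernel γ z w = (starRingEnd ℂ) (hartogsKernel γ w z) := by
  rw [hartogsKernel, hartogsKernel, Complex.conj_tsum]
  refine tsum_congr fun α => ?_
  simp only [map_mul, Complex.conj_ofReal, Complex.conj_conj]
  ring

/-- Integrating termwise gives the Laurent series of `f` at `z`. Summing over the power of `z₂`
recovers the slice coefficients, and what remains is the Taylor series of `f (·, z.2)`. -/
theorem hartogsKernel_reproducing {γ : ℝ} (hγ : 0 < γ) {f : ℂ × ℂ → ℂ}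
    (hf : MemBergmanSpace (hartogsTriangle γ) f) {z : ℂ × ℂ} (hz : z ∈ hartogsTriangle γ) :
    f z = ∫ w in hartogsTriangle γ, hartogsKernel γ z w * f w := by
  obtain ⟨⟨h0, h1⟩, h2⟩ := (mem_hartogsTriangle_iff hγ z).1 hz
  choose c hc hcint using exists_laurentCoeff hγ hf
  set F : ℕ × ℕ → ℂ × ℂ → ℂ := fun α w => (hartogsCoeff γ α : ℂ) * hartogsMonomial γ α z *
    ((starRingEnd ℂ) (hartogsMonomial γ α w) * f w) with hF
  have hstar : ∀ α, MemLp (fun w => (starRingEnd ℂ) (hartogsMonomial γ α w)) 2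
      (volume.restrict (hartogsTriangle γ)) := fun α =>
    (memBergmanSpace_hartogsMonomial hγ α).2.star
  have hFint : ∀ α, Integrable (F α) (volume.restrict (hartogsTriangle γ)) := fun α =>
    ((hstar α).integrable_mul hf.2).const_mul _
  have hFsum : Summable fun α => ∫ w in hartogsTriangle γ, ‖F α w‖ := by
    set N := (eLpNorm f 2 (volume.restrict (hartogsTriangle γ))).toReal
    refine Summable.of_nonneg_of_le (fun α => integral_nonneg fun w => norm_nonneg _) (fun α => ?_)
      ((summable_norm_hartogsMonomial hγ hz).mul_right N)
    have hk := hartogsCoeff_pos γ α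
    have h3 := integral_norm_mul_le_eLpNorm (hstar α) hf.2
    have h4 : eLpNorm (fun w => (starRingEnd ℂ) (hartogsMonomial γ α w)) 2
        (volume.restrict (hartogsTriangle γ)) = ENNReal.ofReal (√(hartogsCoeff γ α))⁻¹ := by
      rw [← eLpNorm_hartogsMonomial hγ]
      exact eLpNorm_congr_norm_ae (ae_of_all _ fun w => RCLike.norm_conj _)
    rw [h4, ENNReal.toReal_ofReal (by positivity)] at h3
    simp only [hF, norm_mul _ ((starRingEnd ℂ) (hartogsMonomial γ α _) * f _)]
    rw [integral_const_mul, norm_mul, Complex.norm_real, Real.norm_of_nonneg hk.le]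
    calc _ ≤ hartogsCoeff γ α * ‖hartogsMonomial γ α z‖ * ((√(hartogsCoeff γ α))⁻¹ * N) := by
          gcongr
      _ = (hartogsCoeff γ α / √(hartogsCoeff γ α)) * ‖hartogsMonomial γ α z‖ * N := by ring
      _ ≤ _ := by
        rw [Real.div_sqrt]
        gcongr
        exact sqrt_hartogsCoeff_le γ α
  have hsum := hasSum_integral_of_summable_integral_norm hFint hFsum
  have hval : ∀ α : ℕ × ℕ, ∫ w in hartogsTriangle γ, F α w =
      z.1 ^ α.1 * (c α.1 α.2 * z.2 ^ (lowExp γ α.1 + α.2)) := fun α => by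
    have hk : (hartogsCoeff γ α : ℂ) ≠ 0 := by exact_mod_cast (hartogsCoeff_pos γ α).ne'
    simp only [hF]
    rw [integral_const_mul, hcint α.1 α.2, hartogsMonomial, Complex.ofReal_inv]
    field_simp
  simp only [hval] at hsum
  have hfib := hsum.prod_fiberwise fun a => (hc a z.2 h0 h1).mul_left (z.1 ^ a)
  have htaylor := hasSum_taylorCoeff (hf.1.slice (w := z.2) (s := Metric.ball 0 (‖z.2‖ ^ γ⁻¹))
    fun u hu => (mem_hartogsTriangle_iff hγ _).2 ⟨⟨h0, h1⟩, by simpa using hu⟩)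
    (z := z.1) (by simpa using h2)
  have heq := (htaylor.congr_fun fun a => mul_comm _ _).unique hfib
  refine Eq.trans heq (setIntegral_congr_fun (measurableSet_hartogsTriangle hγ) fun w hw => ?_)
  simp only [hF]
  rw [hartogsKernel, ← tsum_mul_right]
  refine tsum_congr fun α => ?_
  ring

/-- Every generalized Hartogs triangle has a Bergman kernel. -/
theorem isBergmanKernel_hartogsKernel {γ : ℝ} (hγ : 0 < γ) :
    IsBergmanKernel (hartogsTriangle γ) (hartogsKernel γ) where
  mem _ hw := memBergmanSpace_hartogsKernel hγ hw
  conj_symm z _ w _ := hartogsKernel_conj_symm γ z w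
  reproducing _ hf _ hz := hartogsKernel_reproducing hγ hf hz

/-! ### Closed form of the kernel for rational exponents -/

theorem ceilL_eq_iff {m : ℕ} (hm : 0 < m) (n j : ℕ) (L : ℤ) :
    ceilL m n j = L ↔ (m : ℤ) * (L - 1) < n * (j + 1) + 1 ∧ (n : ℤ) * (j + 1) + 1 ≤ m * L := by
  have hm' : (0 : ℚ) < m := by exact_mod_cast hm
  rw [ceilL, Int.ceil_eq_iff, lt_div_iff₀ hm', div_le_iff₀ hm']
  refine and_congr ?_ ?_
  · rw [← Int.cast_lt (R := ℚ)]
    push_cast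
    constructor <;> intro h <;> linarith
  · rw [← Int.cast_le (R := ℚ)]
    push_cast
    constructor <;> intro h <;> linarith

theorem lowExp_div_eq_iff {m n : ℕ} (hm : 0 < m) (hn : 0 < n) (j : ℕ) (b : ℤ) :
    lowExp ((m : ℝ) / n) j = b ↔
      (m : ℤ) * b ≤ -(n * (j + 1)) ∧ -((n : ℤ) * (j + 1)) < m * (b + 1) := by
  have hm' : (0 : ℝ) < m := by exact_mod_cast hm
  have hn' : (0 : ℝ) < n := by exact_mod_cast hn
  rw [lowExp, Int.floor_eq_iff,
    show -(((j : ℝ) + 1) / ((m : ℝ) / n)) = -((n : ℝ) * (j + 1)) / m by field_simp,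
    le_div_iff₀ hm', div_lt_iff₀ hm']
  refine and_congr ?_ ?_
  · rw [← Int.cast_le (R := ℝ)]
    push_cast
    constructor <;> intro h <;> linarith
  · rw [← Int.cast_lt (R := ℝ)]
    push_cast
    constructor <;> intro h <;> linarith

theorem ceilL_mem_Icc {m n j : ℕ} (hn : 1 ≤ n) (hj : j + 1 < m) :
    1 ≤ ceilL m n j ∧ ceilL m n j ≤ n := by
  obtain ⟨h1, h2⟩ := (ceilL_eq_iff (by omega) n j _).1 (rfl : ceilL m n j = _)
  have hj' : (j : ℤ) + 2 ≤ m := by exact_mod_cast hj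
  have hn' : (1 : ℤ) ≤ n := by exact_mod_cast hn
  constructor
  · by_contra h
    push Not at h
    nlinarith
  · by_contra h
    push Not at h
    nlinarith

/-- With `k = n (j + 1)`, the integers `⌈k / m⌉` and `⌈(k + 1) / m⌉` differ only if `m ∣ k`, which
coprimality excludes for `j + 1 < m`. The class `j = m - 1` is the exception. -/
theorem lowExp_eq_neg_ceilL {m n j : ℕ} (hn : 1 ≤ n) (hmn : Nat.Coprime m n) (hj : j + 1 < m) :
    lowExp ((m : ℝ) / n) j = -ceilL m n j := by
  obtain ⟨h1, h2⟩ := (ceilL_eq_iff (by omega) n j _).1 (rfl : ceilL m n j = _)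
  rw [lowExp_div_eq_iff (by omega) hn]
  have hne : (m : ℤ) * (ceilL m n j - 1) ≠ n * (j + 1) := fun h => by
    have hd : (m : ℤ) ∣ ((n * (j + 1) : ℕ) : ℤ) := ⟨_, by push_cast; exact h.symm⟩
    have := Nat.le_of_dvd (by omega) (hmn.dvd_of_dvd_mul_left (Int.natCast_dvd_natCast.1 hd))
    omega
  constructor
  · linarith
  · have := lt_of_le_of_ne (Int.lt_add_one_iff.1 h1) hne
    linarith

theorem lowExp_add_mul {m n : ℕ} (hm : 0 < m) (hn : 0 < n) (j q : ℕ) :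
    lowExp ((m : ℝ) / n) (j + m * q) = lowExp ((m : ℝ) / n) j - n * q := by
  obtain ⟨h1, h2⟩ := (lowExp_div_eq_iff hm hn j _).1 rfl
  rw [lowExp_div_eq_iff hm hn]
  push_cast
  constructor
  · linear_combination h1
  · linear_combination h2

theorem hartogsWeight_add_mul {m n : ℕ} (hm : 0 < m) (hn : 0 < n) (j q : ℕ) :
    hartogsWeight ((m : ℝ) / n) (j + m * q, 0) = hartogsWeight ((m : ℝ) / n) (j, 0) := by
  have hm' : (m : ℝ) ≠ 0 := by exact_mod_cast hm.ne'
  simp only [hartogsWeight, lowExp_add_mul hm hn]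
  push_cast
  field_simp
  ring

theorem hasSum_add_mul_geometric {y : ℂ} (hy : ‖y‖ < 1) (A B : ℂ) :
    HasSum (fun q : ℕ => (A + B * q) * y ^ q) (A / (1 - y) + B * y / (1 - y) ^ 2) := by
  have h1 := (hasSum_geometric_of_norm_lt_one hy).mul_left A
  have h2 := (hasSum_coe_mul_geometric_of_norm_lt_one hy).mul_left B
  rw [show A / (1 - y) + B * y / (1 - y) ^ 2 = A * (1 - y)⁻¹ + B * (y / (1 - y) ^ 2) by ring]
  exact (h1.add h2).congr_fun fun q => by ring

/-- The range of `(z₁ w̄₁, z₂ w̄₂)` for `z`, `w` in `hartogsTriangle (m / n)`. -/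
theorem hartogsTriangle_mul_conj {m n : ℕ} (hm : 0 < m) (hn : 0 < n) {z w : ℂ × ℂ}
    (hz : z ∈ hartogsTriangle ((m : ℝ) / n)) (hw : w ∈ hartogsTriangle ((m : ℝ) / n)) {s t : ℂ}
    (hs : s = z.1 * (starRingEnd ℂ) w.1) (ht : t = z.2 * (starRingEnd ℂ) w.2) :
    t ≠ 0 ∧ ‖t‖ < 1 ∧ ‖s ^ m / t ^ n‖ < 1 := by
  have hγ : 0 < (m : ℝ) / n := by positivity
  have hz' := (mem_hartogsTriangle_iff hγ z).1 hz
  have hw' := (mem_hartogsTriangle_iff hγ w).1 hw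
  have ht0 : t ≠ 0 := by
    rw [ht]
    exact mul_ne_zero (snd_ne_zero_of_mem hγ hz)
      ((_root_.map_ne_zero _).2 (snd_ne_zero_of_mem hγ hw))
  have hmul : ‖s‖ < ‖t‖ ^ ((m : ℝ) / n)⁻¹ := by
    rw [hs, ht, norm_mul, norm_mul, RCLike.norm_conj, RCLike.norm_conj,
      Real.mul_rpow (norm_nonneg _) (norm_nonneg _)]
    exact mul_lt_mul'' hz'.2 hw'.2 (norm_nonneg _) (norm_nonneg _)
  have ht0' : 0 < ‖t‖ := norm_pos_iff.2 ht0
  refine ⟨ht0, ?_, ?_⟩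
  · rw [ht, norm_mul, RCLike.norm_conj]
    exact mul_lt_one_of_nonneg_of_lt_one_left (norm_nonneg _) hz'.1.2 hw'.1.2.le
  · rw [norm_div, norm_pow, norm_pow, div_lt_one (by positivity)]
    have h := pow_lt_pow_left₀ hmul (norm_nonneg _) hm.ne'
    rwa [← Real.rpow_natCast (‖t‖ ^ _), ← Real.rpow_mul ht0'.le,
      show ((m : ℝ) / n)⁻¹ * m = (n : ℝ) by field_simp, Real.rpow_natCast] at h

/-- For fixed `a` the weight grows by 1 with each power of `t`. Writing `a = j + m q`, passing to
the next `q` multiplies the monomial by `s^m / t^n`, raises `a + 1` by `m` and keeps the weight. -/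
theorem hartogsKernel_div_eq_sum {m n : ℕ} (hm : 0 < m) (hn : 0 < n) {z w : ℂ × ℂ}
    (hz : z ∈ hartogsTriangle ((m : ℝ) / n)) (hw : w ∈ hartogsTriangle ((m : ℝ) / n)) {s t : ℂ}
    (hs : s = z.1 * (starRingEnd ℂ) w.1) (ht : t = z.2 * (starRingEnd ℂ) w.2) :
    (Real.pi : ℂ) ^ 2 * hartogsKernel ((m : ℝ) / n) z w =
      ∑ j : Fin m, s ^ (j : ℕ) * t ^ lowExp ((m : ℝ) / n) j *
        (hartogsWeight ((m : ℝ) / n) (j, 0) / (1 - t) + 1 * t / (1 - t) ^ 2) *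
        (((j : ℕ) + 1 : ℂ) / (1 - s ^ m / t ^ n) +
          m * (s ^ m / t ^ n) / (1 - s ^ m / t ^ n) ^ 2) := by
  set γ := (m : ℝ) / n with hγdef
  have hγ : 0 < γ := by positivity
  obtain ⟨ht0, ht1, hy1⟩ := hartogsTriangle_mul_conj hm hn hz hw hs ht
  have hsum : HasSum (fun α : ℕ × ℕ => ((α.1 : ℂ) + 1) * hartogsWeight γ α * s ^ α.1 *
      t ^ (lowExp γ α.1 + α.2)) ((Real.pi : ℂ) ^ 2 * hartogsKernel γ z w) := by
    refine ((hasSum_hartogsKernel hγ hz hw).mul_left _).congr_fun fun α => ?_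
    have hpi : (Real.pi : ℂ) ≠ 0 := by exact_mod_cast Real.pi_ne_zero
    simp only [hartogsCoeff, hartogsMonomial, hs, ht, mul_pow, mul_zpow, map_mul, map_pow,
      map_zpow₀]
    push_cast
    field_simp
  set T : ℕ → ℂ := fun a => ((a : ℂ) + 1) * s ^ a * t ^ lowExp γ a *
    (hartogsWeight γ (a, 0) / (1 - t) + 1 * t / (1 - t) ^ 2) with hT
  have hsumT : HasSum T ((Real.pi : ℂ) ^ 2 * hartogsKernel γ z w) := by
    refine hsum.prod_fiberwise fun a => ?_
    refine ((hasSum_add_mul_geometric ht1 (hartogsWeight γ (a, 0)) 1).mul_left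
      (((a : ℂ) + 1) * s ^ a * t ^ lowExp γ a)).congr_fun fun i => ?_
    simp only [hartogsWeight]
    rw [zpow_add₀ ht0, zpow_natCast]
    push_cast
    ring
  have : NeZero m := ⟨hm.ne'⟩
  have hsumE : HasSum (fun p : ℕ × Fin m => T (p.2 + m * p.1))
      ((Real.pi : ℂ) ^ 2 * hartogsKernel γ z w) := by
    refine ((Nat.divModEquiv m).symm.hasSum_iff.2 hsumT).congr_fun fun p => ?_
    simp [Nat.divModEquiv, add_comm, mul_comm]
  have hsumQ := hsumE.prod_fiberwise fun q => hasSum_fintype _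
  refine hsumQ.unique (hasSum_sum fun j _ => ?_)
  refine ((hasSum_add_mul_geometric hy1 ((j : ℕ) + 1 : ℂ) m).mul_left
    (s ^ (j : ℕ) * t ^ lowExp γ j *
        (hartogsWeight γ (j, 0) / (1 - t) + 1 * t / (1 - t) ^ 2))).congr_fun fun q => ?_
  simp only [hT, hγdef, lowExp_add_mul hm hn, hartogsWeight_add_mul hm hn]
  rw [zpow_sub₀ ht0, pow_add, pow_mul, div_pow, ← pow_mul t,
    show ((n : ℤ) * q) = ((n * q : ℕ) : ℤ) by push_cast; ring, zpow_natCast]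
  push_cast
  ring

/-- The general `A` covers both evaluation at a point `(s, t)` and the substitution of `X` for both
variables. -/
theorem aeval_numeratorP {A : Type*} [CommRing A] [Algebra ℂ A] (m n : ℕ) (v : Fin 2 → A) :
    MvPolynomial.aeval v (numeratorP m n) =
      (m : A) ^ 2 * v 0 ^ (m - 1) * v 1 ^ n +
      ∑ j ∈ Finset.range (m - 1), v 0 ^ j *
        ((((j + 1) * (kappa m n j + 1) : ℤ) : A) * v 1 ^ (2 * n - ceilL m n j).toNat +
          (((j + 1) * (m - kappa m n j - 1) : ℤ) : A) * v 1 ^ (2 * n + 1 - ceilL m n j).toNat +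
          (((m - j - 1) * (kappa m n j + 1) : ℤ) : A) * v 0 ^ m *
            v 1 ^ (n - ceilL m n j).toNat +
          (((m - j - 1) * (m - kappa m n j - 1) : ℤ) : A) * v 0 ^ m *
            v 1 ^ (n + 1 - ceilL m n j).toNat) := by
  simp only [numeratorP, map_add, map_mul, map_pow, map_sum, map_natCast, map_intCast,
    MvPolynomial.aeval_X]
  rw [add_assoc, add_assoc, add_assoc, ← Finset.sum_add_distrib, ← Finset.sum_add_distrib,
    ← Finset.sum_add_distrib]
  congr 1
  refine Finset.sum_congr rfl fun j _ => ?_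
  rw [pow_add]
  ring

/-- The Bergman kernel of `hartogsTriangle (m / n)` in closed form. -/
theorem hartogsKernel_div_mul_eq {m n : ℕ} (hn : 1 ≤ n) (hnm : n < m) (hmn : Nat.Coprime m n)
    {z w : ℂ × ℂ} (hz : z ∈ hartogsTriangle ((m : ℝ) / n))
    (hw : w ∈ hartogsTriangle ((m : ℝ) / n)) {s t : ℂ}
    (hs : s = z.1 * (starRingEnd ℂ) w.1) (ht : t = z.2 * (starRingEnd ℂ) w.2) :
    m * (Real.pi : ℂ) ^ 2 * (1 - t) ^ 2 * (t ^ n - s ^ m) ^ 2 *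
        hartogsKernel ((m : ℝ) / n) z w =
      MvPolynomial.aeval ![s, t] (numeratorP m n) := by
  have hm : 0 < m := by omega
  obtain ⟨ht0, ht1, hy1⟩ := hartogsTriangle_mul_conj hm hn hz hw hs ht
  have hN : t ^ n ≠ 0 := pow_ne_zero _ ht0
  have h1t : 1 - t ≠ 0 := sub_ne_zero.2 fun h => by simp [← h] at ht1
  have h1y : 1 - s ^ m / t ^ n ≠ 0 := sub_ne_zero.2 fun h => by simp [← h] at hy1
  have hYN : t ^ n - s ^ m = t ^ n * (1 - s ^ m / t ^ n) := by field_simp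
  have hA : ∀ X : ℂ, (1 - t) ^ 2 * (X / (1 - t) + 1 * t / (1 - t) ^ 2) = X * (1 - t) + t := by
    intro X; field_simp
  have hB : ∀ c : ℂ, (t ^ n - s ^ m) ^ 2 * (c / (1 - s ^ m / t ^ n) +
      m * (s ^ m / t ^ n) / (1 - s ^ m / t ^ n) ^ 2) =
      t ^ n * (c * (t ^ n - s ^ m) + m * s ^ m) := by
    intro c
    rw [hYN]
    generalize hy : s ^ m / t ^ n = y at *
    have hYy : s ^ m = t ^ n * y := by rw [← hy]; field_simp
    rw [hYy]
    field_simp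
  have hterm : ∀ j : ℕ, (m : ℂ) * (1 - t) ^ 2 * (t ^ n - s ^ m) ^ 2 *
      (s ^ j * t ^ lowExp ((m : ℝ) / n) j *
        (hartogsWeight ((m : ℝ) / n) (j, 0) / (1 - t) + 1 * t / (1 - t) ^ 2) *
        (((j : ℕ) + 1 : ℂ) / (1 - s ^ m / t ^ n) +
          m * (s ^ m / t ^ n) / (1 - s ^ m / t ^ n) ^ 2)) =
      s ^ j * t ^ lowExp ((m : ℝ) / n) j * t ^ n *
        (m * hartogsWeight ((m : ℝ) / n) (j, 0) * (1 - t) + m * t) *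
        (((j : ℂ) + 1) * (t ^ n - s ^ m) + m * s ^ m) := fun j => by
    linear_combination (m : ℂ) * s ^ j * t ^ lowExp ((m : ℝ) / n) j * ((1 - t) ^ 2 *
      (hartogsWeight ((m : ℝ) / n) (j, 0) / (1 - t) + 1 * t / (1 - t) ^ 2)) * hB (j + 1) +
      (m : ℂ) * s ^ j * t ^ lowExp ((m : ℝ) / n) j * t ^ n *
        (((j : ℂ) + 1) * (t ^ n - s ^ m) + m * s ^ m) * hA (hartogsWeight ((m : ℝ) / n) (j, 0))
  have hweight : ∀ j : ℕ, (m : ℂ) * hartogsWeight ((m : ℝ) / n) (j, 0) =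
      m * lowExp ((m : ℝ) / n) j + m + n * (j + 1) := fun j => by
    have hm' : (m : ℂ) ≠ 0 := by exact_mod_cast hm.ne'
    simp only [hartogsWeight]
    push_cast
    field_simp
    ring
  calc _ = (m : ℂ) * (1 - t) ^ 2 * (t ^ n - s ^ m) ^ 2 *
        ((Real.pi : ℂ) ^ 2 * hartogsKernel ((m : ℝ) / n) z w) := by ring
    _ = ∑ j ∈ Finset.range (m - 1 + 1), s ^ j * t ^ lowExp ((m : ℝ) / n) j * t ^ n *
        (m * hartogsWeight ((m : ℝ) / n) (j, 0) * (1 - t) + m * t) *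
        (((j : ℂ) + 1) * (t ^ n - s ^ m) + m * s ^ m) := by
      rw [hartogsKernel_div_eq_sum hm hn hz hw hs ht, Finset.mul_sum]
      simp only [hterm]
      rw [Nat.sub_add_cancel hm]
      exact Fin.sum_univ_eq_sum_range (fun j => s ^ j * t ^ lowExp ((m : ℝ) / n) j * t ^ n *
        (m * hartogsWeight ((m : ℝ) / n) (j, 0) * (1 - t) + m * t) *
        (((j : ℂ) + 1) * (t ^ n - s ^ m) + m * s ^ m)) m
    _ = _ := by
      rw [Finset.sum_range_succ, aeval_numeratorP, add_comm]
      congr 1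
      · have hlast : lowExp ((m : ℝ) / n) (m - 1) = -(n : ℤ) := by
          rw [lowExp_div_eq_iff hm hn]
          have : ((m - 1 : ℕ) : ℤ) + 1 = m := by omega
          rw [this]
          constructor
          · linarith [mul_comm (m : ℤ) n]
          · have : (0 : ℤ) < m := by exact_mod_cast hm
            linarith [mul_comm (m : ℤ) n]
        have hc : ((m - 1 : ℕ) : ℂ) + 1 = m := by
          rw [Nat.cast_sub hm]; push_cast; ring
        have hw1 : (m : ℂ) * hartogsWeight ((m : ℝ) / n) (m - 1, 0) = m := by
          rw [hweight, hlast, hc]; push_cast; ring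
        have hlow : t ^ (-(n : ℤ)) * t ^ n = 1 := by
          rw [zpow_neg, zpow_natCast, inv_mul_cancel₀ hN]
        simp only [Matrix.cons_val_zero, Matrix.cons_val_one]
        rw [hlast, hc, hw1, mul_assoc (s ^ (m - 1)), hlow]
        ring
      · refine Finset.sum_congr rfl fun j hj => ?_
        have hj' : j + 1 < m := by have := Finset.mem_range.1 hj; omega
        obtain ⟨hL1, hLn⟩ := ceilL_mem_Icc hn hj'
        have hlow := lowExp_eq_neg_ceilL hn hmn hj'
        -- The factors become `(κ + 1) + (m - κ - 1) t` and `(j + 1) t^n + (m - j - 1) s^m`; their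
        -- product yields the four sums of the numerator.
        have hkap : (m : ℂ) * hartogsWeight ((m : ℝ) / n) (j, 0) = kappa m n j + 1 := by
          rw [hweight, hlow, kappa]; push_cast; ring
        have hz2 : ∀ k : ℤ, 0 ≤ k → t ^ k.toNat = t ^ k := fun k hk => by
          rw [← zpow_natCast, Int.toNat_of_nonneg hk]
        have hpows : ∀ k : ℤ, t ^ (k - ceilL m n j) = t ^ k * t ^ (-ceilL m n j) := fun k => by
          rw [← zpow_add₀ ht0, sub_eq_add_neg]
        simp only [Matrix.cons_val_zero, Matrix.cons_val_one]
        rw [hz2 _ (by omega), hz2 _ (by omega), hz2 _ (by omega), hz2 _ (by omega), hpows, hpows,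
          hpows, hpows, hlow, hkap, zpow_add_one₀ ht0,
          zpow_add_one₀ ht0, zpow_natCast,
          show (2 * n : ℤ) = ((n * 2 : ℕ) : ℤ) by push_cast; ring, zpow_natCast, pow_mul]
        push_cast
        ring

/-! ### Self-reciprocal polynomials -/

/-- The roots of `r² - w r + 1` have product 1, so one lies in the open disc unless `‖r‖ = 1`; in
that case `w = 2 Re r` would be in `[-2, 2]`. -/
theorem exists_add_inv_eq {w : ℂ} (hw : ∀ x : ℝ, -2 ≤ x → x ≤ 2 → w ≠ x) :
    ∃ r : ℂ, r ≠ 0 ∧ ‖r‖ < 1 ∧ r + r⁻¹ = w := by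
  obtain ⟨d, hd⟩ := IsAlgClosed.exists_pow_nat_eq (w ^ 2 - 4) (two_pos)
  set r := (w + d) / 2 with hr
  have hq : r * (w - r) = 1 := by rw [hr]; linear_combination (-1 / 4 : ℂ) * hd
  have hr0 : r ≠ 0 := fun h => by simp [h] at hq
  have hinv : r⁻¹ = w - r := inv_eq_of_mul_eq_one_right hq
  have hsum : r + r⁻¹ = w := by rw [hinv]; ring
  rcases lt_trichotomy ‖r‖ 1 with h | h | h
  · exact ⟨r, hr0, h, hsum⟩
  · refine absurd ?_ (hw (2 * r.re) ?_ ?_)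
    · rw [← hsum, Complex.inv_eq_conj h, Complex.add_conj]
    · linarith [neg_le_of_abs_le (Complex.abs_re_le_norm r)]
    · linarith [le_of_abs_le (Complex.abs_re_le_norm r)]
  · refine ⟨r⁻¹, inv_ne_zero hr0, ?_, by rw [inv_inv, add_comm, hsum]⟩
    rw [norm_inv]
    exact inv_lt_one_of_one_lt₀ h

/-- The polynomial with leading coefficient `c` and roots `r`, `r⁻¹` for `r ∈ S`. -/
noncomputable def reciprocalPoly (c : ℂ) (S : Multiset ℂ) : ℂ[X] :=
  C c * ((S + S.map (·⁻¹)).map fun r => X - C r).prod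

theorem roots_reciprocalPoly {c : ℂ} (hc : c ≠ 0) (S : Multiset ℂ) :
    (reciprocalPoly c S).roots = S + S.map (·⁻¹) := by
  rw [reciprocalPoly, roots_C_mul _ hc, roots_multiset_prod_X_sub_C]

theorem reciprocalPoly_ne_zero {c : ℂ} (hc : c ≠ 0) (S : Multiset ℂ) :
    reciprocalPoly c S ≠ 0 :=
  mul_ne_zero (C_ne_zero.2 hc) (monic_multiset_prod_of_monic _ _ fun r _ => monic_X_sub_C r).ne_zero

theorem natDegree_reciprocalPoly {c : ℂ} (hc : c ≠ 0) (S : Multiset ℂ) :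
    (reciprocalPoly c S).natDegree = 2 * S.card := by
  rw [reciprocalPoly, natDegree_C_mul hc, natDegree_multiset_prod_X_sub_C_eq_card,
    Multiset.card_add, Multiset.card_map]
  ring

theorem eval_reciprocalPoly_ne_zero {c : ℂ} (hc : c ≠ 0) {S : Multiset ℂ}
    (hS : ∀ r ∈ S, r ≠ 0 ∧ ‖r‖ < 1) {s : ℂ} (hs : s = 0 ∨ ‖s‖ = 1) :
    (reciprocalPoly c S).eval s ≠ 0 := fun h => by
  have hmem := (mem_roots (reciprocalPoly_ne_zero hc S)).2 h
  rw [roots_reciprocalPoly hc, Multiset.mem_add, Multiset.mem_map] at hmem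
  rcases hmem with hmem | ⟨r, hr, rfl⟩
  · rcases hs with rfl | hs
    · exact (hS _ hmem).1 rfl
    · exact (hS _ hmem).2.ne hs
  · rcases hs with hs | hs
    · exact (hS _ hr).1 (inv_eq_zero.1 hs)
    · rw [norm_inv, inv_eq_one] at hs
      exact (hS _ hr).2.ne hs

theorem countP_roots_reciprocalPoly {c : ℂ} (hc : c ≠ 0) {S : Multiset ℂ}
    (hS : ∀ r ∈ S, r ≠ 0 ∧ ‖r‖ < 1) [DecidablePred fun s : ℂ => s ≠ 0 ∧ ‖s‖ < 1] :
    (reciprocalPoly c S).roots.countP (fun s : ℂ => s ≠ 0 ∧ ‖s‖ < 1) = S.card := by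
  rw [roots_reciprocalPoly hc, Multiset.countP_add, Multiset.countP_eq_card.2 hS,
    Multiset.countP_eq_zero.2, add_zero]
  intro s hs h
  obtain ⟨r, hr, rfl⟩ := Multiset.mem_map.1 hs
  have h1 := h.2
  rw [norm_inv] at h1
  exact absurd (one_lt_inv₀ (norm_pos_iff.2 (hS r hr).1) |>.2 (hS r hr).2) (not_lt.2 h1.le)

theorem reciprocalPoly_singleton {c r w : ℂ} (hr : r ≠ 0) (hw : r + r⁻¹ = w) :
    reciprocalPoly c {r} = C c * (X ^ 2 - C w * X + 1) := by
  have h : C r * C r⁻¹ = (1 : ℂ[X]) := by rw [← C_mul, mul_inv_cancel₀ hr, C_1]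
  simp only [reciprocalPoly, Multiset.map_singleton, Multiset.map_add, Multiset.prod_add,
    Multiset.prod_singleton, ← hw, C_add]
  linear_combination C c * h

theorem reciprocalPoly_pair {c r₁ r₂ w₁ w₂ : ℂ} (h₁ : r₁ ≠ 0) (hw₁ : r₁ + r₁⁻¹ = w₁)
    (h₂ : r₂ ≠ 0) (hw₂ : r₂ + r₂⁻¹ = w₂) :
    reciprocalPoly c {r₁, r₂} =
      C c * (X ^ 4 - C (w₁ + w₂) * X ^ 3 + C (2 + w₁ * w₂) * X ^ 2 - C (w₁ + w₂) * X + 1) := by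
  have e₁ := reciprocalPoly_singleton (c := 1) h₁ hw₁
  have e₂ := reciprocalPoly_singleton (c := 1) h₂ hw₂
  simp only [reciprocalPoly, Multiset.map_singleton, Multiset.map_add, Multiset.prod_add,
    Multiset.prod_singleton, C_1, one_mul, Multiset.insert_eq_cons, Multiset.map_cons,
    Multiset.prod_cons] at e₁ e₂ ⊢
  rw [show ∀ a b c d : ℂ[X], a * b * (c * d) = (a * c) * (b * d) by intros; ring, e₁, e₂]
  simp only [C_add, C_mul, map_ofNat]
  ring

/-! ### The numerator on the diagonal -/

theorem sum_range_quadratic (a b c : ℂ) (N : ℕ) :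
    ∑ j ∈ Finset.range N, (a + b * j + c * (j : ℂ) ^ 2) =
      a * N + b * (N * (N - 1) / 2) + c * (N * (N - 1) * (2 * N - 1) / 6) := by
  induction N with
  | zero => simp
  | succ N ih => rw [Finset.sum_range_succ, ih]; push_cast; ring

theorem sum_range_C_quadratic (a b c : ℂ) (N : ℕ) :
    ∑ j ∈ Finset.range N, C (a + b * j + c * (j : ℂ) ^ 2) =
      C (a * N + b * (N * (N - 1) / 2) + c * (N * (N - 1) * (2 * N - 1) / 6)) := by
  rw [← map_sum, sum_range_quadratic]

theorem eval_diagonalP (m n : ℕ) (s : ℂ) :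
    (diagonalP m n).eval s = MvPolynomial.aeval ![s, s] (numeratorP m n) := by
  rw [diagonalP, ← Polynomial.coe_aeval_eq_eval, ← AlgHom.comp_apply, MvPolynomial.comp_aeval]
  congr 2
  ext i
  fin_cases i <;> simp

/-- Here `L(j) = j + 1` and `κ(j) = n - j - 1`, so the powers of `X` no longer depend on `j` and the
coefficients are quadratic in `j`. -/
theorem diagonalP_succ {n : ℕ} (hn : 1 ≤ n) :
    diagonalP (n + 1) n = X ^ (2 * n - 1) *
      (C ((n : ℂ) * (n + 1) * (n + 2) / 6) * (X ^ 2 + 1) +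
        C (((n : ℂ) + 1) ^ 2 + n * (n + 1) * (2 * n + 1) / 3) * X) := by
  have hterm : ∀ j ∈ Finset.range n, (X : ℂ[X]) ^ j *
      ((((j + 1) * (kappa (n + 1) n j + 1) : ℤ) : ℂ[X]) * X ^ (2 * n - ceilL (n + 1) n j).toNat +
        (((j + 1) * ((n + 1 : ℕ) - kappa (n + 1) n j - 1) : ℤ) : ℂ[X]) *
          X ^ (2 * n + 1 - ceilL (n + 1) n j).toNat +
        ((((n + 1 : ℕ) - j - 1) * (kappa (n + 1) n j + 1) : ℤ) : ℂ[X]) * X ^ (n + 1) *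
          X ^ (n - ceilL (n + 1) n j).toNat +
        ((((n + 1 : ℕ) - j - 1) * ((n + 1 : ℕ) - kappa (n + 1) n j - 1) : ℤ) : ℂ[X]) *
          X ^ (n + 1) * X ^ (n + 1 - ceilL (n + 1) n j).toNat) =
      X ^ (2 * n - 1) * (C ((n : ℂ) + (n - 1) * j + (-1) * (j : ℂ) ^ 2) * (X ^ 2 + 1) +
        C ((n ^ 2 + 1 : ℂ) + (2 - 2 * n) * j + 2 * (j : ℂ) ^ 2) * X) := by
    intro j hj
    have hj' := Finset.mem_range.1 hj
    have hL : ceilL (n + 1) n j = j + 1 := by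
      rw [ceilL_eq_iff (by omega)]
      push_cast
      constructor <;> nlinarith
    have hk : kappa (n + 1) n j = n - j - 1 := by rw [kappa, hL]; push_cast; ring
    obtain ⟨i, rfl⟩ : ∃ i, n = j + 1 + i := ⟨n - j - 1, by omega⟩
    rw [hL, hk, show (2 * ((j + 1 + i : ℕ) : ℤ) - (j + 1)).toNat = j + 1 + 2 * i by omega,
      show (2 * ((j + 1 + i : ℕ) : ℤ) + 1 - (j + 1)).toNat = j + 2 + 2 * i by omega,
      show (((j + 1 + i : ℕ) : ℤ) - (j + 1)).toNat = i by omega,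
      show (((j + 1 + i : ℕ) : ℤ) + 1 - (j + 1)).toNat = i + 1 by omega,
      show 2 * (j + 1 + i) - 1 = 2 * j + 1 + 2 * i by omega]
    simp only [C_add, C_mul, C_sub, C_pow, C_neg, C_1, map_natCast, map_ofNat]
    push_cast
    ring
  rw [diagonalP, aeval_numeratorP, Nat.add_sub_cancel, Finset.sum_congr rfl hterm,
    ← Finset.mul_sum, Finset.sum_add_distrib, ← Finset.sum_mul, ← Finset.sum_mul,
    sum_range_C_quadratic, sum_range_C_quadratic]
  have hX : (X : ℂ[X]) ^ n * X ^ n = X ^ (2 * n - 1) * X := by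
    rw [← pow_add, ← pow_succ]; congr 1; omega
  rw [mul_assoc, hX, show ((n + 1 : ℕ) : ℂ[X]) ^ 2 = C (((n : ℂ) + 1) ^ 2) by simp,
    show (n : ℂ) * n + (n - 1) * (n * (n - 1) / 2) + (-1) * (n * (n - 1) * (2 * n - 1) / 6) =
      n * (n + 1) * (n + 2) / 6 by ring,
    show (n ^ 2 + 1 : ℂ) * n + (2 - 2 * n) * (n * (n - 1) / 2) + 2 * (n * (n - 1) * (2 * n - 1) / 6)
      = n * (n + 1) * (2 * n + 1) / 3 by ring, C_add]
  ring

/-- Here `L(j) = j + 1` for `j < h` and `L(j) = j` for `h ≤ j < 2h`. In powers of `X`, the two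
halves contribute `u, 2u, v, 4u, 0` and its reversal `0, 4u, v, 2u, u`, whence the symmetry. -/
theorem diagonalP_two {h : ℕ} (hh : 1 ≤ h) :
    diagonalP (2 * h + 1) (2 * h - 1) = X ^ (2 * (2 * h - 1) - 1) *
      (C ((h : ℂ) * (h + 1) * (2 * h + 1) / 6) * (X ^ 4 + 6 * X ^ 3 + 10 * X ^ 2 + 6 * X + 1) +
        C (2 * (h : ℂ) + 1) * X ^ 2) := by
  set m := 2 * h + 1 with hm
  set n := 2 * h - 1 with hn
  set T : ℕ → ℂ[X] := fun j => X ^ j *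
      ((((j + 1) * (kappa m n j + 1) : ℤ) : ℂ[X]) * X ^ (2 * n - ceilL m n j).toNat +
        (((j + 1) * (m - kappa m n j - 1) : ℤ) : ℂ[X]) *
          X ^ (2 * n + 1 - ceilL m n j).toNat +
        (((m - j - 1) * (kappa m n j + 1) : ℤ) : ℂ[X]) * X ^ m *
          X ^ (n - ceilL m n j).toNat +
        (((m - j - 1) * (m - kappa m n j - 1) : ℤ) : ℂ[X]) *
          X ^ m * X ^ (n + 1 - ceilL m n j).toNat) with hT
  have hfirst : ∀ j ∈ Finset.range h, T j = X ^ (2 * n - 1) *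
      (C ((2 * h - 1 : ℂ) + (2 * h - 3) * j + (-2) * (j : ℂ) ^ 2) +
        C ((2 : ℂ) + 4 * j + 2 * (j : ℂ) ^ 2) * X +
        C ((2 * h * (2 * h - 1) : ℂ) + (1 - 6 * h) * j + 2 * (j : ℂ) ^ 2) * X ^ 2 +
        C ((4 * h : ℂ) + (4 * h - 2) * j + (-2) * (j : ℂ) ^ 2) * X ^ 3) := by
    intro j hj
    obtain ⟨i, hi⟩ : ∃ i, h = j + 1 + i := ⟨h - j - 1, by have := Finset.mem_range.1 hj; omega⟩
    have hn' : n = 2 * j + 1 + 2 * i := by omega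
    have hm' : m = 2 * j + 3 + 2 * i := by omega
    have hL : ceilL m n j = j + 1 := by
      rw [ceilL_eq_iff (by omega), hn', hm']
      push_cast
      constructor <;> nlinarith
    have hk : kappa m n j = 2 * i := by rw [kappa, hL, hn', hm']; push_cast; ring
    simp only [hT]
    rw [hL, hk, show (2 * (n : ℤ) - (j + 1)).toNat = 3 * j + 1 + 4 * i by omega,
      show (2 * (n : ℤ) + 1 - (j + 1)).toNat = 3 * j + 2 + 4 * i by omega,
      show ((n : ℤ) - (j + 1)).toNat = j + 2 * i by omega,
      show ((n : ℤ) + 1 - (j + 1)).toNat = j + 2 * i + 1 by omega,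
      show 2 * n - 1 = 4 * j + 1 + 4 * i by omega, hm', hi]
    simp only [C_add, C_mul, C_sub, C_pow, C_neg, C_1, map_natCast, map_ofNat]
    push_cast
    ring
  have hsecond : ∀ i ∈ Finset.range h, T (h + i) = X ^ (2 * n - 1) *
      (C ((2 * h * (h + 1) : ℂ) + (-2) * i + (-2) * (i : ℂ) ^ 2) * X +
        C ((h + 1 : ℂ) + (2 * h + 3) * i + 2 * (i : ℂ) ^ 2) * X ^ 2 +
        C ((2 * h ^ 2 : ℂ) + (-4 * h) * i + 2 * (i : ℂ) ^ 2) * X ^ 3 +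
        C ((h : ℂ) + (2 * h - 1) * i + (-2) * (i : ℂ) ^ 2) * X ^ 4) := by
    intro i hi
    obtain ⟨k, hk⟩ : ∃ k, h = i + 1 + k := ⟨h - i - 1, by have := Finset.mem_range.1 hi; omega⟩
    have hn' : n = 2 * i + 1 + 2 * k := by omega
    have hm' : m = 2 * i + 3 + 2 * k := by omega
    have hL : ceilL m n (h + i) = h + i := by
      rw [ceilL_eq_iff (by omega), hn', hm', hk]
      push_cast
      constructor <;> nlinarith
    have hkap : kappa m n (h + i) = 2 * k + 1 := by
      rw [kappa, hL, hn', hm', hk]; push_cast; ring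
    simp only [hT]
    rw [hL, hkap, show (2 * (n : ℤ) - (h + i)).toNat = 2 * i + 1 + 3 * k by omega,
      show (2 * (n : ℤ) + 1 - (h + i)).toNat = 2 * i + 2 + 3 * k by omega,
      show ((n : ℤ) - (h + i)).toNat = k by omega,
      show ((n : ℤ) + 1 - (h + i)).toNat = k + 1 by omega,
      show 2 * n - 1 = 4 * i + 1 + 4 * k by omega, hm', hk]
    simp only [C_add, C_mul, C_sub, C_pow, C_neg, C_1, map_natCast, map_ofNat]
    push_cast
    ring
  have hX : (X : ℂ[X]) ^ (m - 1) * X ^ n = X ^ (2 * n - 1) * X ^ 2 := by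
    rw [← pow_add, ← pow_add]; congr 1; omega
  have hsplit : ∑ j ∈ Finset.range (m - 1), T j =
      ∑ j ∈ Finset.range h, T j + ∑ i ∈ Finset.range h, T (h + i) := by
    rw [show m - 1 = h + h by omega, Finset.sum_range_add]
  rw [diagonalP, aeval_numeratorP, hsplit, Finset.sum_congr rfl hfirst,
    Finset.sum_congr rfl hsecond, mul_assoc, hX]
  simp only [← Finset.mul_sum, Finset.sum_add_distrib, ← Finset.sum_mul]
  simp only [sum_range_C_quadratic]
  rw [show ((m : ℕ) : ℂ[X]) ^ 2 = C ((2 * (h : ℂ) + 1) ^ 2) by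
    rw [C_pow, ← C_eq_natCast, hm]; push_cast; rfl]
  set u : ℂ := (h : ℂ) * (h + 1) * (2 * h + 1) / 6 with hu
  set v : ℂ := 5 * u - h * (2 * h + 1) with hv
  have hCv : C ((2 * (h : ℂ) + 1) ^ 2) + C v + C v = 10 * C u + C (2 * (h : ℂ) + 1) := by
    rw [show (10 : ℂ[X]) = C 10 from (map_ofNat C 10).symm, ← C_mul, ← C_add, ← C_add, ← C_add, hv]
    congr 1
    ring
  have hC2 : C (2 * u) = 2 * C u := by rw [C_mul]; rfl
  have hC4 : C (4 * u) = 4 * C u := by rw [C_mul]; rfl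
  rw [show (2 * h - 1 : ℂ) * h + (2 * h - 3) * (h * (h - 1) / 2) +
      (-2) * (h * (h - 1) * (2 * h - 1) / 6) = u by rw [hu]; ring,
    show (2 : ℂ) * h + 4 * (h * (h - 1) / 2) + 2 * (h * (h - 1) * (2 * h - 1) / 6) = 2 * u by
      rw [hu]; ring,
    show (2 * h * (2 * h - 1) : ℂ) * h + (1 - 6 * h) * (h * (h - 1) / 2) +
      2 * (h * (h - 1) * (2 * h - 1) / 6) = v by rw [hv, hu]; ring,
    show (4 * h : ℂ) * h + (4 * h - 2) * (h * (h - 1) / 2) +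
      (-2) * (h * (h - 1) * (2 * h - 1) / 6) = 4 * u by rw [hu]; ring,
    show (2 * h * (h + 1) : ℂ) * h + (-2) * (h * (h - 1) / 2) +
      (-2) * (h * (h - 1) * (2 * h - 1) / 6) = 4 * u by rw [hu]; ring,
    show (h + 1 : ℂ) * h + (2 * h + 3) * (h * (h - 1) / 2) +
      2 * (h * (h - 1) * (2 * h - 1) / 6) = v by rw [hv, hu]; ring,
    show (2 * h ^ 2 : ℂ) * h + (-4 * h) * (h * (h - 1) / 2) +
      2 * (h * (h - 1) * (2 * h - 1) / 6) = 2 * u by rw [hu]; ring,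
    show (h : ℂ) * h + (2 * h - 1) * (h * (h - 1) / 2) +
      (-2) * (h * (h - 1) * (2 * h - 1) / 6) = u by rw [hu]; ring, hC2, hC4]
  linear_combination X ^ (2 * n - 1) * X ^ 2 * hCv

/-- For `m - n ∈ {1, 2}` the polynomial `Q_{m,n}` has `m - n` pairs of roots `r`, `r⁻¹`. -/
theorem exists_diagonalP_eq_reciprocalPoly {m n : ℕ} (hn : 1 ≤ n) (hnm : n < m)
    (hmn : Nat.Coprime m n) (hd : m - n = 1 ∨ m - n = 2) :
    ∃ (c : ℂ) (S : Multiset ℂ), c ≠ 0 ∧ S.card = m - n ∧ (∀ r ∈ S, r ≠ 0 ∧ ‖r‖ < 1) ∧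
      diagonalP m n = X ^ (2 * n - 1) * reciprocalPoly c S := by
  rcases hd with hd | hd
  · obtain rfl : m = n + 1 := by omega
    set A : ℝ := (n : ℝ) * (n + 1) * (n + 2) / 6 with hA
    set B : ℝ := ((n : ℝ) + 1) ^ 2 + n * (n + 1) * (2 * n + 1) / 3 with hB
    have hn' : (1 : ℝ) ≤ n := by exact_mod_cast hn
    have hA0 : 0 < A := by positivity
    -- The equation for `w = s + s⁻¹` is `A w + B = 0`, so this says that its root is below `-2`.
    have hBA : 2 * A < B := by
      have : B - 2 * A = ((n : ℝ) + 1) ^ 2 + n * (n + 1) * (n - 1) / 3 := by rw [hA, hB]; ring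
      have h2 : 0 ≤ (n : ℝ) * (n + 1) * (n - 1) / 3 := by
        have : 0 ≤ (n : ℝ) - 1 := by linarith
        positivity
      nlinarith
    have hA0' : (A : ℂ) ≠ 0 := by exact_mod_cast hA0.ne'
    obtain ⟨r, hr0, hr1, hr⟩ := exists_add_inv_eq (w := ((-B / A : ℝ) : ℂ)) fun x hx _ h => by
      have h' : -B / A = x := by exact_mod_cast h
      rw [← h', le_div_iff₀ hA0] at hx
      linarith
    refine ⟨A, {r}, hA0', by simp, by simp [hr0, hr1], ?_⟩
    rw [diagonalP_succ hn, reciprocalPoly_singleton hr0 hr]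
    have hCA : C ((n : ℂ) * (n + 1) * (n + 2) / 6) = C (A : ℂ) := by rw [hA]; push_cast; rfl
    have hCB : C (((n : ℂ) + 1) ^ 2 + n * (n + 1) * (2 * n + 1) / 3) =
        -(C (A : ℂ) * C ((-B / A : ℝ) : ℂ)) := by
      rw [← C_mul, ← C_neg]
      congr 1
      push_cast
      rw [mul_div_cancel₀ _ hA0', neg_neg, hB]
      push_cast
      rfl
    rw [hCA, hCB]
    ring
  · obtain ⟨h, hh⟩ : ∃ h, n = 2 * h - 1 ∧ 1 ≤ h := by
      have hodd : ¬ 2 ∣ n := fun h2 => by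
        have : 2 ∣ m := by omega
        have := Nat.dvd_gcd this h2
        rw [hmn] at this
        omega
      exact ⟨(n + 1) / 2, by omega, by omega⟩
    obtain ⟨rfl, hh⟩ := hh
    obtain rfl : m = 2 * h + 1 := by omega
    set u : ℝ := (h : ℝ) * (h + 1) * (2 * h + 1) / 6 with hu
    set v : ℝ := 2 * (h : ℝ) + 1 with hv
    have hh' : (1 : ℝ) ≤ h := by exact_mod_cast hh
    have hu0 : 0 < u := by positivity
    have hv0 : 0 < v := by positivity
    have hu0' : (u : ℂ) ≠ 0 := by exact_mod_cast hu0.ne'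
    -- In `w = s + s⁻¹` the quartic reads `u ((w + 3)² - 1) + v`, so `w = -3 ± d`. A real `w ≥ -2`
    -- would have `(w + 3)² ≥ 1 > 1 - v / u`. The number `d` may be imaginary or zero.
    obtain ⟨d, hd⟩ := IsAlgClosed.exists_pow_nat_eq ((1 - v / u : ℝ) : ℂ) two_pos
    have hout : ∀ e : ℂ, e ^ 2 = ((1 - v / u : ℝ) : ℂ) → ∀ x : ℝ, -2 ≤ x → x ≤ 2 →
        -3 + e ≠ x := fun e he x hx _ h => by
      have h1 : e = ((x + 3 : ℝ) : ℂ) := by push_cast; linear_combination h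
      rw [h1] at he
      have h2 : (x + 3) ^ 2 = 1 - v / u := by exact_mod_cast he
      have h3 : 0 < v / u := by positivity
      nlinarith
    obtain ⟨r₁, h₁, h₁', hr₁⟩ := exists_add_inv_eq (hout d hd)
    obtain ⟨r₂, h₂, h₂', hr₂⟩ := exists_add_inv_eq (hout (-d) (by rw [neg_sq, hd]))
    refine ⟨u, {r₁, r₂}, hu0', by simp; omega, by simp [h₁, h₂, h₁', h₂'], ?_⟩
    rw [diagonalP_two hh, reciprocalPoly_pair h₁ hr₁ h₂ hr₂]
    have hCu : C ((h : ℂ) * (h + 1) * (2 * h + 1) / 6) = C (u : ℂ) := by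
      rw [hu, hv]; push_cast; rfl
    have hsum : C (-3 + d + (-3 + -d)) = (-6 : ℂ[X]) := by
      rw [show -3 + d + (-3 + -d) = -6 by ring, C_neg]; rfl
    have hprod : C (u : ℂ) * C (2 + (-3 + d) * (-3 + -d)) =
        10 * C (u : ℂ) + C (2 * (h : ℂ) + 1) := by
      rw [show (10 : ℂ[X]) = C 10 from (map_ofNat C 10).symm, ← C_mul, ← C_mul, ← C_add]
      congr 1
      have hdu : (u : ℂ) * d ^ 2 = u - v := by
        rw [hd]; push_cast; field_simp
      have hvh : (v : ℂ) = 2 * h + 1 := by rw [hv]; push_cast; rfl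
      linear_combination -hdu + hvh
    rw [hCu, hsum]
    linear_combination -X ^ (2 * (2 * h - 1) - 1) * X ^ 2 * hprod

/-! ### From roots on the diagonal to zeros of the kernel -/

theorem hartogsTriangle_diagonal_mem {γ : ℝ} (hγ : 1 < γ) {x : ℂ} (h0 : x ≠ 0) (h1 : ‖x‖ < 1) :
    (x, x) ∈ hartogsTriangle γ :=
  ⟨by simpa using Real.rpow_lt_rpow_of_exponent_gt (norm_pos_iff.2 h0) h1 hγ, h1⟩

/-- A root of `Q_{m,n}` in the punctured unit disc is a zero of the Bergman kernel. -/
theorem bergmanKernelHasZeros_of_root {m n : ℕ} (hn : 1 ≤ n) (hnm : n < m)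
    (hmn : Nat.Coprime m n) {r : ℂ} (h0 : r ≠ 0) (h1 : ‖r‖ < 1) (hr : (diagonalP m n).eval r = 0) :
    BergmanKernelHasZeros (hartogsTriangle ((m : ℝ) / n)) := by
  have hn' : (0 : ℝ) < n := by exact_mod_cast hn
  have hγ : 1 < (m : ℝ) / n := by
    rw [one_lt_div hn']; exact_mod_cast hnm
  have hr0 : 0 < ‖r‖ := norm_pos_iff.2 h0
  -- Splitting `r = (r / ρ) * ρ` into factors of modulus `√‖r‖ < 1` realises `s = t = r` by two
  -- diagonal points of the domain.
  set ρ : ℝ := √‖r‖ with hρ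
  have hρ0 : 0 < ρ := Real.sqrt_pos.2 hr0
  have hρ0' : (ρ : ℂ) ≠ 0 := by exact_mod_cast hρ0.ne'
  have hρ1 : ρ < 1 := by rw [hρ, Real.sqrt_lt' one_pos]; simpa using h1
  have hrρ : ‖r / ρ‖ = ρ := by
    rw [norm_div, Complex.norm_real, Real.norm_of_nonneg hρ0.le, hρ, Real.div_sqrt]
  have hw : ((ρ : ℂ), (ρ : ℂ)) ∈ hartogsTriangle ((m : ℝ) / n) :=
    hartogsTriangle_diagonal_mem hγ hρ0' (by rwa [Complex.norm_real, Real.norm_of_nonneg hρ0.le])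
  have hz : (r / ρ, r / ρ) ∈ hartogsTriangle ((m : ℝ) / n) :=
    hartogsTriangle_diagonal_mem hγ (div_ne_zero h0 hρ0') (by rwa [hrρ])
  have hst : r = r / ρ * (starRingEnd ℂ) (ρ : ℂ) := by
    rw [Complex.conj_ofReal, div_mul_cancel₀ _ hρ0']
  refine ⟨_, isBergmanKernel_hartogsKernel (by linarith), _, hz, _, hw, ?_⟩
  have hmain := hartogsKernel_div_mul_eq hn hnm hmn hz hw hst hst
  rw [← eval_diagonalP, hr] at hmain
  obtain ⟨ht0, ht1, hy1⟩ := hartogsTriangle_mul_conj (by omega) hn hz hw hst hst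
  have hne1 : (1 - r : ℂ) ≠ 0 := sub_ne_zero.2 fun h => by simp [← h] at ht1
  have hne2 : r ^ n - r ^ m ≠ 0 := fun h => by
    rw [← sub_eq_zero.1 h, div_self (pow_ne_zero _ ht0), norm_one] at hy1
    exact lt_irrefl _ hy1
  have hne3 : (m : ℂ) ≠ 0 := by exact_mod_cast (by omega : m ≠ 0)
  have hne4 : (Real.pi : ℂ) ≠ 0 := by exact_mod_cast Real.pi_ne_zero
  refine (mul_eq_zero.1 hmain).resolve_left ?_
  exact mul_ne_zero (mul_ne_zero (mul_ne_zero hne3 (pow_ne_zero _ hne4)) (pow_ne_zero _ hne1))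
    (pow_ne_zero _ hne2)

theorem bergmanKernelHasZeros_hartogsTriangle {m n : ℕ} (hn : 1 ≤ n) (hnm : n < m)
    (hmn : Nat.Coprime m n) (hd : m - n = 1 ∨ m - n = 2) :
    BergmanKernelHasZeros (hartogsTriangle ((m : ℝ) / n)) := by
  obtain ⟨c, S, hc, hcard, hS, hdiag⟩ := exists_diagonalP_eq_reciprocalPoly hn hnm hmn hd
  obtain ⟨r, hr⟩ := Multiset.card_pos_iff_exists_mem.1 (by omega : 0 < S.card)
  refine bergmanKernelHasZeros_of_root hn hnm hmn (hS r hr).1 (hS r hr).2 ?_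
  have hroot : r ∈ (reciprocalPoly c S).roots := by
    rw [roots_reciprocalPoly hc]
    exact Multiset.mem_add.2 (Or.inl hr)
  rw [hdiag, eval_mul, (mem_roots'.1 hroot).2, mul_zero]

theorem bergmanKernelHasZeros_succ_div {l : ℕ} (hl : 1 ≤ l) :
    BergmanKernelHasZeros (hartogsTriangle (((l : ℝ) + 1) / l)) := by
  have h := bergmanKernelHasZeros_hartogsTriangle hl (Nat.lt_succ_self l) (by simp) (by simp)
  simpa using h

theorem bergmanKernelHasZeros_odd_div {l : ℕ} (hl : 1 ≤ l) :
    BergmanKernelHasZeros (hartogsTriangle ((2 * (l : ℝ) + 1) / (2 * l - 1))) := by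
  have hcop : Nat.Coprime (2 * l + 1) (2 * l - 1) := by
    obtain ⟨k, rfl⟩ : ∃ k, l = k + 1 := ⟨l - 1, by omega⟩
    rw [show 2 * (k + 1) + 1 = 2 + (2 * (k + 1) - 1) by omega, Nat.coprime_add_self_left,
      Nat.coprime_two_left, show 2 * (k + 1) - 1 = 2 * k + 1 by omega]
    exact odd_two_mul_add_one k
  have h := bergmanKernelHasZeros_hartogsTriangle (by omega) (by omega) hcop (by omega)
  rw [Nat.cast_sub (by omega)] at h
  push_cast at h
  exact h

theorem theorem1p3 :
    (∀ m n : ℕ, 1 ≤ n → n < m → Nat.Coprime m n → (m - n = 1 ∨ m - n = 2) →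
      -- `Q_{m,n}` is a genuine polynomial of degree `2m - 2n`
      X ^ (2 * n - 1) * polyQ m n = diagonalP m n ∧
      (polyQ m n).natDegree = 2 * (m - n) ∧
      -- it has no root on the unit circle (nor at the origin)
      (∀ s : ℂ, ‖s‖ = 1 → (polyQ m n).eval s ≠ 0) ∧
      (polyQ m n).eval 0 ≠ 0 ∧
      -- exactly half of its `2m - 2n` roots, with multiplicity, are in the punctured unit disc
      (polyQ m n).roots.card = 2 * (m - n) ∧
      (polyQ m n).roots.countP (fun s : ℂ => s ≠ 0 ∧ ‖s‖ < 1) = m - n ∧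
      -- the Bergman kernel has zeros
      BergmanKernelHasZeros (hartogsTriangle ((m : ℝ) / n))) ∧
    -- first sequence
    ((∀ l : ℕ, 1 ≤ l → 1 < ((l : ℝ) + 1) / l ∧
        BergmanKernelHasZeros (hartogsTriangle (((l : ℝ) + 1) / l))) ∧
      StrictAntiOn (fun l : ℕ => ((l : ℝ) + 1) / l) (Set.Ici 1) ∧
      Tendsto (fun l : ℕ => ((l : ℝ) + 1) / l) atTop (𝓝 1)) ∧
    -- second sequence
    ((∀ l : ℕ, 1 ≤ l → 1 < (2 * (l : ℝ) + 1) / (2 * l - 1) ∧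
        BergmanKernelHasZeros (hartogsTriangle ((2 * (l : ℝ) + 1) / (2 * l - 1)))) ∧
      StrictAntiOn (fun l : ℕ => (2 * (l : ℝ) + 1) / (2 * l - 1)) (Set.Ici 1) ∧
      Tendsto (fun l : ℕ => (2 * (l : ℝ) + 1) / (2 * l - 1)) atTop (𝓝 1)) ∧
    -- no interval `(1, 1 + ε)` consists of parameters with zero-free kernels
    (∀ ε : ℝ, 0 < ε → ∃ γ ∈ Set.Ioo 1 (1 + ε), BergmanKernelHasZeros (hartogsTriangle γ)) := by
  have hseq1 : ∀ l : ℕ, 1 ≤ l → 1 < ((l : ℝ) + 1) / l := fun l hl => by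
    have hl' : (0 : ℝ) < l := by exact_mod_cast hl
    rw [one_lt_div hl']
    linarith
  have hlim1 : Tendsto (fun l : ℕ => ((l : ℝ) + 1) / l) atTop (𝓝 1) := by
    have h := (tendsto_one_div_atTop_nhds_zero_nat (𝕜 := ℝ)).const_add 1
    rw [add_zero] at h
    refine h.congr' ?_
    filter_upwards [eventually_ge_atTop 1] with l hl
    have hl' : (l : ℝ) ≠ 0 := by positivity
    field_simp
  refine ⟨fun m n hn hnm hmn hd => ?_,
    ⟨fun l hl => ⟨hseq1 l hl, bergmanKernelHasZeros_succ_div hl⟩, ?_, hlim1⟩,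
    ⟨fun l hl => ⟨?_, bergmanKernelHasZeros_odd_div hl⟩, ?_, ?_⟩, fun ε hε => ?_⟩
  · obtain ⟨c, S, hc, hcard, hS, hdiag⟩ := exists_diagonalP_eq_reciprocalPoly hn hnm hmn hd
    have hQ : polyQ m n = reciprocalPoly c S := by
      rw [polyQ, hdiag, mul_div_cancel_left₀ _ (pow_ne_zero _ X_ne_zero)]
    rw [hQ]
    refine ⟨hdiag.symm, ?_, fun s hs => eval_reciprocalPoly_ne_zero hc hS (Or.inr hs),
      eval_reciprocalPoly_ne_zero hc hS (Or.inl rfl), ?_, ?_,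
      bergmanKernelHasZeros_hartogsTriangle hn hnm hmn hd⟩
    · rw [natDegree_reciprocalPoly hc, hcard]
    · rw [roots_reciprocalPoly hc, Multiset.card_add, Multiset.card_map, hcard, two_mul]
    · rw [countP_roots_reciprocalPoly hc hS, hcard]
  · intro a ha b hb hab
    have ha' : (1 : ℝ) ≤ a := by exact_mod_cast Set.mem_Ici.1 ha
    have hab' : (a : ℝ) < b := by exact_mod_cast hab
    simp only
    rw [div_lt_div_iff₀ (by linarith) (by linarith)]
    nlinarith
  · have hl' : (1 : ℝ) ≤ l := by exact_mod_cast hl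
    rw [one_lt_div (by linarith)]
    linarith
  · intro a ha b hb hab
    have ha' : (1 : ℝ) ≤ a := by exact_mod_cast Set.mem_Ici.1 ha
    have hab' : (a : ℝ) < b := by exact_mod_cast hab
    simp only
    rw [div_lt_div_iff₀ (by linarith) (by linarith)]
    nlinarith
  · have hden : Tendsto (fun l : ℕ => 2 * (l : ℝ) - 1) atTop atTop :=
      tendsto_atTop_add_const_right _ _
        (tendsto_natCast_atTop_atTop.const_mul_atTop (two_pos : (0 : ℝ) < 2))
    have h := (hden.const_div_atTop 2).const_add 1
    rw [add_zero] at h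
    refine h.congr' ?_
    filter_upwards [eventually_ge_atTop 1] with l hl
    have hl' : (1 : ℝ) ≤ l := by exact_mod_cast hl
    have hne : 2 * (l : ℝ) - 1 ≠ 0 := by linarith
    field_simp
    ring
  · obtain ⟨l, hl, hlt⟩ := ((eventually_ge_atTop 1).and
      (hlim1.eventually (gt_mem_nhds (by linarith : (1 : ℝ) < 1 + ε)))).exists
    exact ⟨_, ⟨hseq1 l hl, hlt⟩, bergmanKernelHasZeros_succ_div hl⟩
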